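/- Let $f=(f(0),f(1),f(2),\dots)$ be a sequence of complex numbers such that for every $l\in\mathbb N=\{0,1,2,\dots\}$ the autocovariance $$\rho_l=\lim_{n\to\infty}\frac1n\sum_{k=0}^{n} f(k)\,\overline{f(k+l)}$$ exists. Let $\tilde{\mathcal H}_f\subset\mathbb C^{\mathbb N}$ be the linear span of the shifted sequences $F_l=(f(l),f(l+1),\dots)$, $l\in\mathbb N$, with the (possibly degenerate) inner product $\langle h,g\rangle=\lim_{n\to\infty}\frac1n\sum_{k=0}^{n-1}h_k\overline{g_k}$ (the limit exists), let $\mathcal H_f$ be the Hilbert space obtained from it by completion (vectors of norm zero being identified with $0$), and let $\mathcal K$ be the isometry of $\mathcal H_f$ that extends the time shift $F_l\mapsto F_{l+1}$. Regard $f=F_0$ as an element of $\mathcal H_f$. Then $f$ has an expansion $$f=\sum_{i\ge1}a_iv_i+f^{\perp},\qquad |a_1|\ge|a_2|\ge\dots\ge0,$$ where the $v_i$ are unit eigenvectors of $\mathcal K$ with pairwise distinct eigenvalues and $f^\perp$ is orthogonal to all eigenvectors of $\mathcal K$; if only finitely many terms occur, we put $a_i=0$ for all further $i$. Moreover, for every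 such expansion the following holds. Let $\delta_{NM,1}\ge\delta_{NM,2}\ge\dots\ge0$ be the singular values, counted with multiplicity and continued by zeros, of the $(N+1)\times(M+1)$ trajectory matrix $$A_{NM}(f)=\bigl(f(i+j)\bigr)_{0\le i\le N,\;0\le j\le M}.$$ Then for every $i\ge1$ the inner limit below exists for every $N\ge1$, the outer limit exists, and $$\lim_{N\to\infty}\lim_{M\to\infty}\frac{\delta_{NM,i}^2}{NM}=|a_i|^2 .$$ -/

import Mathlib

noncomputable section

namespace TimeSeries

open Filter Topology ComplexConjugate

/-- All autocovariances `ρ_l = lim_n (1/n) ∑_{k=0}^{n} f(k) conj (f(k+l))`, `l = 0, 1, 2, …`,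
of the time series `f(0), f(1), …` exist. -/
def AutocovExists (f : ℕ → ℂ) : Prop :=
  ∀ l : ℕ, ∃ ρ : ℂ, Tendsto
    (fun n : ℕ => (1 / (n : ℂ)) * ∑ k ∈ Finset.range (n + 1), f k * conj (f (k + l)))
    atTop (𝓝 ρ)

/-- The time shift `(h₀, h₁, …) ↦ (h₁, h₂, …)` of time series. -/
def shift : (ℕ → ℂ) →ₗ[ℂ] (ℕ → ℂ) where
  toFun h k := h (k + 1)
  map_add' _ _ := rfl
  map_smul' _ _ := rfl

/-- The linear span of the shifted series `F_l = (f(l), f(l+1), …)`, `l = 0, 1, 2, …`. -/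
def krylov (f : ℕ → ℂ) : Submodule ℂ (ℕ → ℂ) :=
  Submodule.span ℂ (Set.range fun l : ℕ => fun k : ℕ => f (k + l))

/-- The time averages `(1/n) ∑_{k<n} conj (h k) * g k`. They are conjugate-linear in the first
argument, as is Mathlib's convention for inner products. -/
def timeAvg (h g : ℕ → ℂ) (n : ℕ) : ℂ :=
  (1 / (n : ℂ)) * ∑ k ∈ Finset.range n, conj (h k) * g k

/-- The limit of the time averages. -/
def meanInner (h g : ℕ → ℂ) : ℂ := limUnder atTop (timeAvg h g)

theorem tendsto_average_shift {u : ℕ → ℂ} {c : ℂ}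
    (h : Tendsto (fun n : ℕ => (1 / (n : ℂ)) * ∑ k ∈ Finset.range n, u k) atTop (𝓝 c)) :
    Tendsto (fun n : ℕ => (1 / (n : ℂ)) * ∑ k ∈ Finset.range n, u (k + 1)) atTop (𝓝 c) := by
  have h1 := h.comp (tendsto_add_atTop_nat 1)
  have h2 : Tendsto (fun n : ℕ => 1 + 1 / (n : ℂ)) atTop (𝓝 (1 + 0)) :=
    tendsto_const_nhds.add tendsto_one_div_atTop_nhds_zero_nat
  have h3 : Tendsto (fun n : ℕ => 1 / (n : ℂ) * u 0) atTop (𝓝 (0 * u 0)) :=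
    tendsto_one_div_atTop_nhds_zero_nat.mul_const _
  have h4 := (h2.mul h1).sub h3
  simp only [add_zero, one_mul, zero_mul, sub_zero] at h4
  refine h4.congr' ?_
  filter_upwards [eventually_ge_atTop 1] with n hn
  have hn0 : (n : ℂ) ≠ 0 := by exact_mod_cast (by omega : n ≠ 0)
  have hn1 : (n : ℂ) + 1 ≠ 0 := by exact_mod_cast (by omega : n + 1 ≠ 0)
  simp only [Function.comp_apply]
  rw [Finset.sum_range_succ']
  push_cast
  field_simp
  ring

theorem tendsto_average_of_succ {u : ℕ → ℂ} {c : ℂ}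
    (h : Tendsto (fun n : ℕ => (1 / (n : ℂ)) * ∑ k ∈ Finset.range (n + 1), u k) atTop (𝓝 c)) :
    Tendsto (fun n : ℕ => (1 / (n : ℂ)) * ∑ k ∈ Finset.range n, u k) atTop (𝓝 c) := by
  rw [← tendsto_add_atTop_iff_nat 1]
  have h2 : Tendsto (fun n : ℕ => 1 - 1 / ((n : ℂ) + 1)) atTop (𝓝 (1 - 0)) :=
    tendsto_const_nhds.sub tendsto_one_div_add_atTop_nhds_zero_nat
  have h4 := h2.mul h
  simp only [sub_zero, one_mul] at h4
  refine h4.congr' ?_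
  filter_upwards [eventually_ge_atTop 1] with n hn
  have hn0 : (n : ℂ) ≠ 0 := by exact_mod_cast (by omega : n ≠ 0)
  have hn1 : (n : ℂ) + 1 ≠ 0 := by exact_mod_cast (by omega : n + 1 ≠ 0)
  push_cast
  field_simp
  ring

theorem timeAvg_conj (h g : ℕ → ℂ) (n : ℕ) : conj (timeAvg h g n) = timeAvg g h n := by
  simp [timeAvg, mul_comm]

theorem tendsto_timeAvg_shift {h g : ℕ → ℂ} {c : ℂ} (H : Tendsto (timeAvg h g) atTop (𝓝 c)) :
    Tendsto (timeAvg (shift h) (shift g)) atTop (𝓝 c) :=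
  tendsto_average_shift (u := fun k => conj (h k) * g k) H

theorem exists_tendsto_generators {f : ℕ → ℂ} (hf : AutocovExists f) (l m : ℕ) :
    ∃ c, Tendsto (timeAvg (fun k => f (k + l)) (fun k => f (k + m))) atTop (𝓝 c) := by
  have base : ∀ d : ℕ, ∃ c, Tendsto (timeAvg (fun k => f (k + d)) f) atTop (𝓝 c) := by
    intro d
    obtain ⟨ρ, hρ⟩ := hf d
    refine ⟨ρ, (tendsto_average_of_succ hρ).congr fun n => ?_⟩
    simp [timeAvg, mul_comm]
  have step : ∀ e d : ℕ, ∃ c,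
      Tendsto (timeAvg (fun k => f (k + (d + e))) (fun k => f (k + e))) atTop (𝓝 c) := by
    intro e
    induction e with
    | zero => exact base
    | succ e ih =>
      intro d
      obtain ⟨c, hc⟩ := ih d
      refine ⟨c, (tendsto_timeAvg_shift hc).congr fun n => ?_⟩
      have e1 : shift (fun k => f (k + (d + e))) = fun k => f (k + (d + (e + 1))) := by
        funext k; exact congrArg f (by omega)
      have e2 : shift (fun k => f (k + e)) = fun k => f (k + (e + 1)) := by
        funext k; exact congrArg f (by omega)
      rw [e1, e2]
  rcases le_total m l with hml | hlm
  · obtain ⟨c, hc⟩ := step m (l - m)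
    rw [Nat.sub_add_cancel hml] at hc
    exact ⟨c, hc⟩
  · obtain ⟨c, hc⟩ := step l (m - l)
    rw [Nat.sub_add_cancel hlm] at hc
    refine ⟨conj c, ((Complex.continuous_conj.tendsto c).comp hc).congr fun n => ?_⟩
    exact timeAvg_conj _ _ n

theorem timeAvg_add_left (h₁ h₂ g : ℕ → ℂ) (n : ℕ) :
    timeAvg (h₁ + h₂) g n = timeAvg h₁ g n + timeAvg h₂ g n := by
  simp [timeAvg, add_mul, Finset.sum_add_distrib, mul_add]

theorem timeAvg_smul_left (a : ℂ) (h g : ℕ → ℂ) (n : ℕ) :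
    timeAvg (a • h) g n = conj a * timeAvg h g n := by
  simp only [timeAvg, Pi.smul_apply, smul_eq_mul, map_mul, mul_assoc, ← Finset.mul_sum]
  ring

theorem exists_tendsto_left {s : Set (ℕ → ℂ)} {g : ℕ → ℂ}
    (H : ∀ h ∈ s, ∃ c, Tendsto (timeAvg h g) atTop (𝓝 c)) {h : ℕ → ℂ}
    (hh : h ∈ Submodule.span ℂ s) : ∃ c, Tendsto (timeAvg h g) atTop (𝓝 c) := by
  induction hh using Submodule.span_induction with
  | mem x hx => exact H x hx
  | zero => exact ⟨0, tendsto_const_nhds.congr fun n => by simp [timeAvg]⟩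
  | add x y _ _ hx hy =>
    obtain ⟨c, hc⟩ := hx
    obtain ⟨d, hd⟩ := hy
    exact ⟨c + d, (hc.add hd).congr fun n => (timeAvg_add_left x y g n).symm⟩
  | smul a x _ hx =>
    obtain ⟨c, hc⟩ := hx
    exact ⟨conj a * c, (hc.const_mul _).congr fun n => (timeAvg_smul_left a x g n).symm⟩

theorem exists_tendsto_conj {h g : ℕ → ℂ} (H : ∃ c, Tendsto (timeAvg h g) atTop (𝓝 c)) :
    ∃ c, Tendsto (timeAvg g h) atTop (𝓝 c) := by
  obtain ⟨c, hc⟩ := H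
  exact ⟨conj c, ((Complex.continuous_conj.tendsto c).comp hc).congr fun n => timeAvg_conj h g n⟩

theorem tendsto_meanInner {f : ℕ → ℂ} (hf : AutocovExists f) {h g : ℕ → ℂ}
    (hh : h ∈ krylov f) (hg : g ∈ krylov f) :
    Tendsto (timeAvg h g) atTop (𝓝 (meanInner h g)) := by
  refine tendsto_nhds_limUnder (exists_tendsto_left ?_ hh)
  rintro _ ⟨l, rfl⟩
  refine exists_tendsto_conj (exists_tendsto_left ?_ hg)
  rintro _ ⟨m, rfl⟩
  exact exists_tendsto_generators hf m l

theorem shift_mem_krylov {f h : ℕ → ℂ} (hh : h ∈ krylov f) : shift h ∈ krylov f := by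
  induction hh using Submodule.span_induction with
  | mem x hx =>
    obtain ⟨l, rfl⟩ := hx
    refine Submodule.subset_span ⟨l + 1, ?_⟩
    funext k
    exact congrArg f (by omega)
  | zero => simp
  | add x y _ _ hx hy => simpa using (krylov f).add_mem hx hy
  | smul a x _ hx => simpa using (krylov f).smul_mem a hx

/-- The space of finite linear combinations of the shifted series, which carries the inner product
given by time averages (and not the topology of pointwise convergence). -/
def PreHilbert (f : ℕ → ℂ) (_hf : AutocovExists f) : Type := krylov f

section

variable (f : ℕ → ℂ) (hf : AutocovExists f)

instance : AddCommGroup (PreHilbert f hf) := inferInstanceAs (AddCommGroup (krylov f))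

instance : Module ℂ (PreHilbert f hf) := inferInstanceAs (Module ℂ (krylov f))

/-- The time series underlying an element of the space. -/
def PreHilbert.val {f : ℕ → ℂ} {hf : AutocovExists f} (h : PreHilbert f hf) : ℕ → ℂ :=
  Subtype.val (p := fun x => x ∈ krylov f) h

theorem PreHilbert.tendsto_inner {f : ℕ → ℂ} {hf : AutocovExists f} (h g : PreHilbert f hf) :
    Tendsto (timeAvg h.val g.val) atTop (𝓝 (meanInner h.val g.val)) :=
  tendsto_meanInner hf (Subtype.property (p := fun x => x ∈ krylov f) h)
    (Subtype.property (p := fun x => x ∈ krylov f) g)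

/-- The (semi-definite) inner product `lim_n (1/n) ∑_{k<n} conj (h k) * g k`. -/
instance PreHilbert.core : PreInnerProductSpace.Core ℂ (PreHilbert f hf) where
  inner h g := meanInner h.val g.val
  conj_inner_symm h g := by
    refine tendsto_nhds_unique
      ((Complex.continuous_conj.tendsto _).comp (PreHilbert.tendsto_inner g h)) ?_
    exact (PreHilbert.tendsto_inner h g).congr fun n => (timeAvg_conj _ _ n).symm
  re_inner_nonneg h := by
    refine ge_of_tendsto ((Complex.continuous_re.tendsto _).comp (PreHilbert.tendsto_inner h h))
      (Eventually.of_forall fun n => ?_)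
    have e : timeAvg h.val h.val n
        = (((1 / (n : ℝ)) * ∑ k ∈ Finset.range n, Complex.normSq (h.val k) : ℝ) : ℂ) := by
      simp [timeAvg, Complex.normSq_eq_conj_mul_self]
    simp only [Function.comp_apply]
    rw [e, Complex.ofReal_re]
    exact mul_nonneg (by positivity) (Finset.sum_nonneg fun k _ => Complex.normSq_nonneg _)
  add_left h₁ h₂ g := by
    refine tendsto_nhds_unique (PreHilbert.tendsto_inner (h₁ + h₂) g) ?_
    exact ((PreHilbert.tendsto_inner h₁ g).add (PreHilbert.tendsto_inner h₂ g)).congr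
      fun n => (timeAvg_add_left _ _ _ n).symm
  smul_left h g a := by
    refine tendsto_nhds_unique (PreHilbert.tendsto_inner (a • h) g) ?_
    exact ((PreHilbert.tendsto_inner h g).const_mul (conj a)).congr
      fun n => (timeAvg_smul_left _ _ _ n).symm

instance : SeminormedAddCommGroup (PreHilbert f hf) :=
  InnerProductSpace.Core.toSeminormedAddCommGroup (𝕜 := ℂ)

instance : InnerProductSpace ℂ (PreHilbert f hf) :=
  InnerProductSpace.ofCore (PreHilbert.core f hf)

/-- The time shift on finite linear combinations of shifted series; it preserves norms. -/
def preKoopman : PreHilbert f hf →ₗᵢ[ℂ] PreHilbert f hf where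
  toFun h := ⟨shift h.val, shift_mem_krylov (Subtype.property (p := fun x => x ∈ krylov f) h)⟩
  map_add' _ _ := rfl
  map_smul' _ _ := rfl
  norm_map' h := by
    have e : meanInner (shift h.val) (shift h.val) = meanInner h.val h.val :=
      (tendsto_timeAvg_shift (PreHilbert.tendsto_inner h h)).limUnder_eq
    exact congrArg (fun z : ℂ => Real.sqrt z.re) e

/-- The Hilbert space `𝓗_f` of the time series: the (Hausdorff) completion. -/
abbrev HilbertSpace : Type := UniformSpace.Completion (PreHilbert f hf)

/-- The Koopman-like time-shift operator `𝓚` on `𝓗_f`. -/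
def koopman : HilbertSpace f hf →L[ℂ] HilbertSpace f hf :=
  (preKoopman f hf).toContinuousLinearMap.completion

/-- The time series `f` as an element of `𝓗_f`. -/
def observable : HilbertSpace f hf :=
  ((show PreHilbert f hf from ⟨f, Submodule.subset_span ⟨0, rfl⟩⟩ : PreHilbert f hf) :
    UniformSpace.Completion (PreHilbert f hf))

/-- `f = ∑ᵢ aᵢ vᵢ + r` is the expansion of `f` in eigenvectors of the time-shift operator:
the `vᵢ` are unit eigenvectors with pairwise distinct eigenvalues `ξᵢ`, `r` is orthogonal to all
eigenvectors, and `|a₀| ≥ |a₁| ≥ …`. If there are only finitely many eigenvectors up to scalars,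
the sequence `a` is continued by zeros; there is no condition on `vᵢ` and `ξᵢ` when `aᵢ = 0`. -/
structure IsEigenExpansion (a ξ : ℕ → ℂ) (v : ℕ → HilbertSpace f hf) (r : HilbertSpace f hf) :
    Prop where
  norm_eq_one : ∀ i, a i ≠ 0 → ‖v i‖ = 1
  eigen : ∀ i, a i ≠ 0 → koopman f hf (v i) = ξ i • v i
  distinct : ∀ i j, a i ≠ 0 → a j ≠ 0 → i ≠ j → ξ i ≠ ξ j
  remainder_orthogonal : ∀ (z : ℂ) (w : HilbertSpace f hf),
    koopman f hf w = z • w → inner ℂ w r = 0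
  hasSum : HasSum (fun i => a i • v i) (observable f hf - r)
  antitone : Antitone fun i => ‖a i‖

end

/-- The trajectory matrix `A_{NM}(f)`, of size `(N+1) × (M+1)`, with entries `f(i+j)`. -/
def trajectoryMatrix (f : ℕ → ℂ) (N M : ℕ) : Matrix (Fin (N + 1)) (Fin (M + 1)) ℂ :=
  Matrix.of fun i j => f ((i : ℕ) + (j : ℕ))

/-- The singular values `δ_{NM,0} ≥ δ_{NM,1} ≥ … ≥ 0` of the trajectory matrix, counted with
multiplicity, indexed from zero, and continued by zeros. -/
def trajectorySingularValue (f : ℕ → ℂ) (N M i : ℕ) : ℝ :=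
  (Matrix.toEuclideanLin (trajectoryMatrix f N M)).singularValues i

end TimeSeries

end

/-!
Let `K` be the isometry of the Hilbert space `H` of the time series. The averages
`n⁻¹ ∑_{k<n} (K^k f) ⊗ (K^k f)*` converge in operator norm: they are Birkhoff averages of the
isometry `T ↦ K T K*` of the space of Hilbert–Schmidt operators, to which the mean ergodic theorem
applies. The limit `L` is compact, self-adjoint and commutes with `K`, and `⟪w, L w⟫ = |⟪f, w⟫|²`
for each eigenvector `w` of `K`. Such an operator is determined by its quadratic form on the
eigenvectors of `K`: for the difference `D` of two of them, `K` maps the finite-dimensional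
eigenspaces of `D` for nonzero eigenvalues into themselves and hence has an eigenvector in each.
So `L = ∑ |a_i|² v_i ⊗ v_i*`, whose eigenvalues are the `|a_i|²`.

For fixed `N`, the squared singular values of the trajectory matrices, divided by `M`, tend to the
eigenvalues of the Gram matrix of `f, K f, …, K^N f`. These are the nonzero eigenvalues of the sum
of rank-one operators above. The eigenvalues of all these forms are compared through their max-min
values, which depend continuously on the form and are defined without a spectral theorem.
-/

open Filter Topology ComplexConjugate Module InnerProductSpace

section MaxMin

variable {𝕜 E F : Type*} [RCLike 𝕜] [NormedAddCommGroup E] [InnerProductSpace 𝕜 E]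
  [NormedAddCommGroup F] [InnerProductSpace 𝕜 F]

variable (𝕜) in
/-- The supremum of all `c` such that `c * ‖x‖ ^ 2 ≤ q x` on a subspace of dimension `i + 1`. If `q`
is a Hermitian form, this is its `i`-th largest eigenvalue (counted from zero), by the
Courant–Fischer principle; it is `0` if there is no subspace of dimension `i + 1`. -/
noncomputable def maxMin (q : E → ℝ) (i : ℕ) : ℝ :=
  sSup {c : ℝ | ∃ V : Submodule 𝕜 E, finrank 𝕜 V = i + 1 ∧ ∀ x ∈ V, c * ‖x‖ ^ 2 ≤ q x}

theorem exists_mem_forall_inner_eq_zero {i : ℕ} (v : ℕ → E) {V : Submodule 𝕜 E}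
    (hV : finrank 𝕜 V = i + 1) : ∃ x ∈ V, x ≠ 0 ∧ ∀ j < i, ⟪v j, x⟫_𝕜 = 0 := by
  have : FiniteDimensional 𝕜 V := .of_finrank_pos (by omega)
  let coords : V →ₗ[𝕜] (Fin i → 𝕜) := LinearMap.pi fun j => (innerₛₗ 𝕜 (v j)).comp V.subtype
  obtain ⟨x, hx, hx0⟩ := coords.ker.exists_mem_ne_zero_of_ne_bot
    (coords.ker_ne_bot_of_finrank_lt (by simp [hV]))
  exact ⟨x, x.2, by simpa using hx0, fun j hj => congrFun hx ⟨j, hj⟩⟩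

theorem le_of_forall_mem_le {q : E → ℝ} {C c : ℝ} (hq : ∀ x, q x ≤ C * ‖x‖ ^ 2) {i : ℕ}
    {V : Submodule 𝕜 E} (hV : finrank 𝕜 V = i + 1) (hc : ∀ x ∈ V, c * ‖x‖ ^ 2 ≤ q x) :
    c ≤ C := by
  obtain ⟨x, hx, hx0, -⟩ := exists_mem_forall_inner_eq_zero 0 hV
  exact le_of_mul_le_mul_right ((hc x hx).trans (hq x)) (by positivity)

theorem le_maxMin {q : E → ℝ} {C c : ℝ} (hq : ∀ x, q x ≤ C * ‖x‖ ^ 2) {i : ℕ}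
    {V : Submodule 𝕜 E} (hV : finrank 𝕜 V = i + 1) (hc : ∀ x ∈ V, c * ‖x‖ ^ 2 ≤ q x) :
    c ≤ maxMin 𝕜 q i :=
  le_csSup ⟨C, by rintro _ ⟨W, hW, h⟩; exact le_of_forall_mem_le hq hW h⟩ ⟨V, hV, hc⟩

theorem maxMin_le {q : E → ℝ} {B : ℝ} (hB : 0 ≤ B) {i : ℕ}
    (h : ∀ (c : ℝ) (V : Submodule 𝕜 E), 0 < c → finrank 𝕜 V = i + 1 →
      (∀ x ∈ V, c * ‖x‖ ^ 2 ≤ q x) → c ≤ B) : maxMin 𝕜 q i ≤ B := by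
  refine Real.sSup_le ?_ hB
  rintro c ⟨V, hV, hc⟩
  rcases le_or_gt c 0 with hc0 | hc0
  · exact hc0.trans hB
  · exact h c V hc0 hV hc

theorem maxMin_nonneg {q : E → ℝ} (hq : ∀ x, 0 ≤ q x) (i : ℕ) : 0 ≤ maxMin 𝕜 q i := by
  by_cases hne : ∃ V : Submodule 𝕜 E, finrank 𝕜 V = i + 1
  · obtain ⟨V, hV⟩ := hne
    exact Real.sSup_nonneg' ⟨0, ⟨V, hV, fun x _ => by simpa using hq x⟩, le_rfl⟩
  · refine Real.sSup_nonneg ?_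
    rintro c ⟨V, hV, -⟩
    exact absurd ⟨V, hV⟩ hne

theorem maxMin_le_add {q q' : E → ℝ} {C ε : ℝ} (hq' : ∀ x, q' x ≤ C * ‖x‖ ^ 2)
    (hq'_nonneg : ∀ x, 0 ≤ q' x) (hε : 0 ≤ ε) (h : ∀ x, q x ≤ q' x + ε * ‖x‖ ^ 2) (i : ℕ) :
    maxMin 𝕜 q i ≤ maxMin 𝕜 q' i + ε := by
  refine maxMin_le (add_nonneg (maxMin_nonneg hq'_nonneg i) hε) fun c V _ hV hc => ?_
  suffices c - ε ≤ maxMin 𝕜 q' i by linarith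
  exact le_maxMin hq' hV fun x hx => by linarith [hc x hx, h x, sub_mul c ε (‖x‖ ^ 2)]

theorem maxMin_const_mul_le {q : E → ℝ} {C t : ℝ} (hq : ∀ x, q x ≤ C * ‖x‖ ^ 2)
    (hq_nonneg : ∀ x, 0 ≤ q x) (ht : 0 < t) (i : ℕ) :
    maxMin 𝕜 (fun x => t * q x) i ≤ t * maxMin 𝕜 q i := by
  refine maxMin_le (mul_nonneg ht.le (maxMin_nonneg hq_nonneg i)) fun c V _ hV hc => ?_
  suffices c / t ≤ maxMin 𝕜 q i by rwa [div_le_iff₀' ht] at this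
  exact le_maxMin hq hV fun x hx => by
    rw [div_mul_eq_mul_div, div_le_iff₀' ht]
    exact hc x hx

theorem maxMin_const_mul {q : E → ℝ} {C t : ℝ} (hq : ∀ x, q x ≤ C * ‖x‖ ^ 2)
    (hq_nonneg : ∀ x, 0 ≤ q x) (ht : 0 < t) (i : ℕ) :
    maxMin 𝕜 (fun x => t * q x) i = t * maxMin 𝕜 q i := by
  refine le_antisymm (maxMin_const_mul_le hq hq_nonneg ht i) ?_
  have hle := maxMin_const_mul_le (𝕜 := 𝕜) (q := fun x => t * q x) (C := t * C)
    (fun x => by rw [mul_assoc]; exact mul_le_mul_of_nonneg_left (hq x) ht.le)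
    (fun x => mul_nonneg ht.le (hq_nonneg x)) (inv_pos.2 ht) i
  simp only [inv_mul_cancel_left₀ ht.ne'] at hle
  rwa [← div_eq_inv_mul, le_div_iff₀' ht] at hle

theorem tendsto_maxMin {ι : Type*} {l : Filter ι} {q : ι → E → ℝ} {q₀ : E → ℝ} {ε : ι → ℝ} {C : ℝ}
    (hq : ∀ n x, 0 ≤ q n x) (hq₀ : ∀ x, 0 ≤ q₀ x) (hC : ∀ x, q₀ x ≤ C * ‖x‖ ^ 2)
    (hε : Tendsto ε l (𝓝 0)) (h : ∀ n x, |q n x - q₀ x| ≤ ε n * ‖x‖ ^ 2) (i : ℕ) :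
    Tendsto (fun n => maxMin 𝕜 (q n) i) l (𝓝 (maxMin 𝕜 q₀ i)) := by
  have habs : ∀ n x, |q n x - q₀ x| ≤ |ε n| * ‖x‖ ^ 2 := fun n x =>
    (h n x).trans (mul_le_mul_of_nonneg_right (le_abs_self _) (by positivity))
  have hupper : ∀ n, maxMin 𝕜 (q n) i ≤ maxMin 𝕜 q₀ i + |ε n| := fun n =>
    maxMin_le_add hC hq₀ (abs_nonneg _) (fun x => by linarith [(abs_le.1 (habs n x)).2]) i
  have hlower : ∀ n, maxMin 𝕜 q₀ i ≤ maxMin 𝕜 (q n) i + |ε n| := fun n =>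
    maxMin_le_add (C := C + |ε n|)
      (fun x => by linarith [(abs_le.1 (habs n x)).2, hC x, add_mul C |ε n| (‖x‖ ^ 2)])
      (hq n) (abs_nonneg _) (fun x => by linarith [(abs_le.1 (habs n x)).1]) i
  rw [tendsto_iff_dist_tendsto_zero]
  refine squeeze_zero (fun n => dist_nonneg) (fun n => ?_) (by simpa using hε.abs)
  rw [Real.dist_eq, abs_le]
  constructor <;> linarith [hupper n, hlower n]

section Diagonal

variable {c : ℕ → ℝ} {v : ℕ → E} {q : E → ℝ}

theorem le_mul_norm_sq_of_forall_inner_eq_zero (hc : Antitone c) (hc0 : ∀ j, 0 ≤ c j)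
    (hv : Orthonormal 𝕜 fun j : {j // c j ≠ 0} => v j)
    (hq : ∀ x, HasSum (fun j => c j * ‖⟪v j, x⟫_𝕜‖ ^ 2) (q x)) {i : ℕ} {x : E}
    (hx : ∀ j < i, ⟪v j, x⟫_𝕜 = 0) : q x ≤ c i * ‖x‖ ^ 2 := by
  classical
  refine hasSum_le_of_sum_le (hq x) fun s => ?_
  calc ∑ j ∈ s, c j * ‖⟪v j, x⟫_𝕜‖ ^ 2
      = ∑ j ∈ s.subtype (c · ≠ 0), c j * ‖⟪v j, x⟫_𝕜‖ ^ 2 := by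
        rw [Finset.sum_subtype_eq_sum_filter (f := fun j => c j * ‖⟪v j, x⟫_𝕜‖ ^ 2),
          Finset.sum_filter_of_ne fun j _ => left_ne_zero_of_mul]
    _ ≤ ∑ j ∈ s.subtype (c · ≠ 0), c i * ‖⟪v j, x⟫_𝕜‖ ^ 2 := by
        refine Finset.sum_le_sum fun j _ => ?_
        rcases lt_or_ge (j : ℕ) i with hj | hj
        · simp [hx j hj]
        · exact mul_le_mul_of_nonneg_right (hc hj) (by positivity)
    _ ≤ c i * ‖x‖ ^ 2 := by
        rw [← Finset.mul_sum]
        exact mul_le_mul_of_nonneg_left (hv.sum_inner_products_le x) (hc0 i)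

theorem sum_norm_sq_inner_eq_of_mem_span {ι : Type*} [Fintype ι] {w : ι → E}
    (hw : Orthonormal 𝕜 w) {x : E} (hx : x ∈ Submodule.span 𝕜 (Set.range w)) :
    ∑ j, ‖⟪w j, x⟫_𝕜‖ ^ 2 = ‖x‖ ^ 2 := by
  obtain ⟨l, rfl⟩ := Submodule.mem_span_range_iff_exists_fun 𝕜 |>.1 hx
  have hnorm := inner_self_eq_norm_sq_to_K (𝕜 := 𝕜) (∑ j, l j • w j)
  rw [hw.inner_sum] at hnorm
  simp only [hw.inner_right_fintype, RCLike.conj_mul] at hnorm ⊢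
  exact_mod_cast hnorm

theorem maxMin_eq_of_hasSum (hc : Antitone c) (hc0 : ∀ j, 0 ≤ c j)
    (hv : Orthonormal 𝕜 fun j : {j // c j ≠ 0} => v j)
    (hq : ∀ x, HasSum (fun j => c j * ‖⟪v j, x⟫_𝕜‖ ^ 2) (q x)) (i : ℕ) :
    maxMin 𝕜 q i = c i := by
  have hterm : ∀ x j, 0 ≤ c j * ‖⟪v j, x⟫_𝕜‖ ^ 2 := fun x j => mul_nonneg (hc0 j) (by positivity)
  apply le_antisymm
  · refine maxMin_le (hc0 i) fun b V _ hV hb => ?_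
    obtain ⟨x, hxV, hx0, hx⟩ := exists_mem_forall_inner_eq_zero v hV
    exact le_of_mul_le_mul_right
      ((hb x hxV).trans (le_mul_norm_sq_of_forall_inner_eq_zero hc hc0 hv hq hx)) (by positivity)
  rcases (hc0 i).eq_or_lt with hi | hi
  · exact hi ▸ maxMin_nonneg (fun x => (hq x).nonneg (hterm x)) i
  have hci : ∀ j : Fin (i + 1), c i ≤ c j := fun j => hc (Nat.lt_succ_iff.1 j.2)
  have hw : Orthonormal 𝕜 fun j : Fin (i + 1) => v j :=
    hv.comp (fun j : Fin (i + 1) => ⟨j, (hi.trans_le (hci j)).ne'⟩) fun j k h =>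
      Fin.ext (congrArg Subtype.val h)
  have hbound : ∀ x, q x ≤ c 0 * ‖x‖ ^ 2 := fun x =>
    le_mul_norm_sq_of_forall_inner_eq_zero hc hc0 hv hq (by simp)
  refine le_maxMin hbound
    ((finrank_span_eq_card hw.linearIndependent).trans (Fintype.card_fin _)) fun x hx => ?_
  calc c i * ‖x‖ ^ 2
      = ∑ j : Fin (i + 1), c i * ‖⟪v j, x⟫_𝕜‖ ^ 2 := by
        rw [← sum_norm_sq_inner_eq_of_mem_span hw hx, Finset.mul_sum]
    _ ≤ ∑ j : Fin (i + 1), c j * ‖⟪v j, x⟫_𝕜‖ ^ 2 :=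
        Finset.sum_le_sum fun j _ => mul_le_mul_of_nonneg_right (hci j) (by positivity)
    _ = ∑ j ∈ Finset.range (i + 1), c j * ‖⟪v j, x⟫_𝕜‖ ^ 2 :=
        Fin.sum_univ_eq_sum_range (fun j => c j * ‖⟪v j, x⟫_𝕜‖ ^ 2) _
    _ ≤ q x := sum_le_hasSum _ (fun j _ => hterm x j) (hq x)

end Diagonal

section SingularValues

variable [FiniteDimensional 𝕜 E] [FiniteDimensional 𝕜 F]

theorem norm_sq_apply_eq_sum_eigenvalues (T : E →ₗ[𝕜] F) {n : ℕ} (hn : finrank 𝕜 E = n) (x : E) :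
    ‖T x‖ ^ 2 = ∑ j, T.isSymmetric_adjoint_comp_self.eigenvalues hn j *
      ‖⟪T.isSymmetric_adjoint_comp_self.eigenvectorBasis hn j, x⟫_𝕜‖ ^ 2 := by
  set hS := T.isSymmetric_adjoint_comp_self
  set b := hS.eigenvectorBasis hn
  have hinner : ∀ j, ⟪b j, (T.adjoint ∘ₗ T) x⟫_𝕜 = hS.eigenvalues hn j * ⟪b j, x⟫_𝕜 := fun j => by
    rw [← hS (b j) x, hS.apply_eigenvectorBasis hn j, inner_smul_left, RCLike.conj_ofReal]
  suffices h : ((‖T x‖ ^ 2 : ℝ) : 𝕜) = (∑ j, hS.eigenvalues hn j * ‖⟪b j, x⟫_𝕜‖ ^ 2 : ℝ) from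
    RCLike.ofReal_injective h
  calc ((‖T x‖ ^ 2 : ℝ) : 𝕜)
      = ⟪x, (T.adjoint ∘ₗ T) x⟫_𝕜 := by
        rw [LinearMap.comp_apply, LinearMap.adjoint_inner_right, inner_self_eq_norm_sq_to_K]
        norm_cast
    _ = ∑ j, ⟪x, b j⟫_𝕜 * ⟪b j, (T.adjoint ∘ₗ T) x⟫_𝕜 := (b.sum_inner_mul_inner _ _).symm
    _ = (∑ j, hS.eigenvalues hn j * ‖⟪b j, x⟫_𝕜‖ ^ 2 : ℝ) := by
        push_cast
        refine Finset.sum_congr rfl fun j _ => ?_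
        rw [← LinearMap.coe_comp, hinner, mul_left_comm, ← inner_conj_symm x, RCLike.conj_mul]

theorem sq_singularValues_eq_maxMin (T : E →ₗ[𝕜] F) (i : ℕ) :
    T.singularValues i ^ 2 = maxMin 𝕜 (fun x => ‖T x‖ ^ 2) i := by
  set n := finrank 𝕜 E with hn
  let b := T.isSymmetric_adjoint_comp_self.eigenvectorBasis hn.symm
  let v : ℕ → E := fun j => if h : j < n then b ⟨j, h⟩ else 0
  have hv_of_lt : ∀ j : Fin n, v j = b j := fun j => dif_pos j.2
  have hlt : ∀ j, T.singularValues j ^ 2 ≠ 0 → j < n := fun j hj => by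
    contrapose! hj
    simp [T.singularValues_of_finrank_le hj]
  have hv : Orthonormal 𝕜 fun j : {j // T.singularValues j ^ 2 ≠ 0} => v j := by
    have hb := b.orthonormal.comp (fun j : {j // T.singularValues j ^ 2 ≠ 0} => ⟨j, hlt j j.2⟩)
      fun j k h => Subtype.ext (congrArg Fin.val h)
    exact (funext fun j : {j // T.singularValues j ^ 2 ≠ 0} => hv_of_lt ⟨j, hlt j j.2⟩) ▸ hb
  refine (maxMin_eq_of_hasSum (fun j k hjk => ?_) (fun j => sq_nonneg _) hv (fun x => ?_) i).symm
  · exact pow_le_pow_left₀ (T.singularValues_nonneg k) (T.singularValues_antitone hjk) 2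
  · rw [norm_sq_apply_eq_sum_eigenvalues T hn.symm]
    simp only [← T.sq_singularValues_fin, ← hv_of_lt, b]
    rw [Fin.sum_univ_eq_sum_range (fun j => T.singularValues j ^ 2 * ‖⟪v j, x⟫_𝕜‖ ^ 2)]
    refine hasSum_sum_of_ne_finset_zero fun j hj => ?_
    rw [not_ne_iff.1 (mt (hlt j) (mt Finset.mem_range.2 hj)), zero_mul]

end SingularValues

section AdjointPair

variable {σ : 𝕜 →+* 𝕜} {τ : 𝕜 →+* 𝕜} {T : E →ₛₗ[σ] F} {S : F →ₛₗ[τ] E} {C : ℝ}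

theorem norm_sq_apply_le_of_norm_inner_eq (hTS : ∀ x y, ‖⟪T x, y⟫_𝕜‖ = ‖⟪x, S y⟫_𝕜‖) (x : E) :
    ‖T x‖ ^ 2 ≤ ‖x‖ * ‖S (T x)‖ := by
  rw [norm_sq_eq_re_inner (𝕜 := 𝕜)]
  exact (RCLike.re_le_norm _).trans ((hTS _ _).trans_le (norm_inner_le_norm _ _))

theorem norm_sq_le_of_norm_inner_eq (hTS : ∀ x y, ‖⟪T x, y⟫_𝕜‖ = ‖⟪x, S y⟫_𝕜‖) (hC : 0 ≤ C)
    (hS : ∀ y, ‖S y‖ ^ 2 ≤ C * ‖y‖ ^ 2) (x : E) : ‖T x‖ ^ 2 ≤ C * ‖x‖ ^ 2 := by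
  rcases (sq_nonneg ‖T x‖).eq_or_lt with h0 | hpos
  · rw [← h0]
    positivity
  refine le_of_mul_le_mul_right ?_ hpos
  calc ‖T x‖ ^ 2 * ‖T x‖ ^ 2 ≤ (‖x‖ * ‖S (T x)‖) * (‖x‖ * ‖S (T x)‖) := by
        gcongr <;> exact norm_sq_apply_le_of_norm_inner_eq hTS x
    _ = ‖S (T x)‖ ^ 2 * ‖x‖ ^ 2 := by ring
    _ ≤ C * ‖T x‖ ^ 2 * ‖x‖ ^ 2 := by gcongr; exact hS (T x)
    _ = C * ‖x‖ ^ 2 * ‖T x‖ ^ 2 := by ring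

theorem mul_norm_sq_apply_le_of_norm_inner_eq (hTS : ∀ x y, ‖⟪T x, y⟫_𝕜‖ = ‖⟪x, S y⟫_𝕜‖) {c : ℝ}
    (hc : 0 ≤ c) {x : E} (hx : c * ‖x‖ ^ 2 ≤ ‖T x‖ ^ 2) :
    c * ‖T x‖ ^ 2 ≤ ‖S (T x)‖ ^ 2 := by
  rcases (sq_nonneg ‖T x‖).eq_or_lt with h0 | hpos
  · rw [← h0, mul_zero]
    positivity
  refine le_of_mul_le_mul_right ?_ hpos
  calc c * ‖T x‖ ^ 2 * ‖T x‖ ^ 2 = c * (‖T x‖ ^ 2 * ‖T x‖ ^ 2) := mul_assoc _ _ _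
    _ ≤ c * ((‖x‖ * ‖S (T x)‖) * (‖x‖ * ‖S (T x)‖)) := by
        gcongr <;> exact norm_sq_apply_le_of_norm_inner_eq hTS x
    _ = c * ‖x‖ ^ 2 * ‖S (T x)‖ ^ 2 := by ring
    _ ≤ ‖T x‖ ^ 2 * ‖S (T x)‖ ^ 2 := by gcongr
    _ = ‖S (T x)‖ ^ 2 * ‖T x‖ ^ 2 := mul_comm _ _

theorem finrank_map_of_injOn [RingHomSurjective σ] {V : Submodule 𝕜 E} (hT : Set.InjOn T V) :
    finrank 𝕜 (V.map T) = finrank 𝕜 V := by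
  let e : V ≃+ V.map T := AddEquiv.ofBijective ((T.submoduleMap V) : V →+ V.map T)
    ⟨fun x y h => Subtype.ext (hT x.2 y.2 (congrArg Subtype.val h)), T.submoduleMap_surjective V⟩
  have hrank := lift_rank_eq_of_equiv_equiv σ e ⟨σ.injective, RingHomSurjective.is_surjective⟩
    fun a x => Subtype.ext (T.map_smulₛₗ a x)
  simpa only [Cardinal.toNat_lift, finrank] using congrArg Cardinal.toNat hrank.symm

theorem maxMin_norm_sq_le [RingHomSurjective σ] (hTS : ∀ x y, ‖⟪T x, y⟫_𝕜‖ = ‖⟪x, S y⟫_𝕜‖)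
    (hS : ∀ y, ‖S y‖ ^ 2 ≤ C * ‖y‖ ^ 2) (i : ℕ) :
    maxMin 𝕜 (fun x => ‖T x‖ ^ 2) i ≤ maxMin 𝕜 (fun y => ‖S y‖ ^ 2) i := by
  refine maxMin_le (maxMin_nonneg (fun y => sq_nonneg _) i) fun c V hc hV hle => ?_
  have hinj : Set.InjOn T V := fun x hx y hy hxy => by
    have hsub := hle (x - y) (V.sub_mem hx hy)
    rw [map_sub, hxy, sub_self, norm_zero, zero_pow two_ne_zero] at hsub
    exact sub_eq_zero.1 (norm_eq_zero.1 (pow_eq_zero_iff two_ne_zero |>.1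
      (le_antisymm (nonpos_of_mul_nonpos_right hsub hc) (sq_nonneg _))))
  refine le_maxMin hS ((finrank_map_of_injOn hinj).trans hV) ?_
  rintro _ ⟨x, hx, rfl⟩
  exact mul_norm_sq_apply_le_of_norm_inner_eq hTS hc.le (hle x hx)

theorem maxMin_norm_sq_eq [RingHomSurjective σ] [RingHomSurjective τ]
    (hTS : ∀ x y, ‖⟪T x, y⟫_𝕜‖ = ‖⟪x, S y⟫_𝕜‖) (hC : 0 ≤ C)
    (hS : ∀ y, ‖S y‖ ^ 2 ≤ C * ‖y‖ ^ 2) (i : ℕ) :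
    maxMin 𝕜 (fun x => ‖T x‖ ^ 2) i = maxMin 𝕜 (fun y => ‖S y‖ ^ 2) i :=
  le_antisymm (maxMin_norm_sq_le hTS hS i)
    (maxMin_norm_sq_le (fun y x => by rw [norm_inner_symm, ← hTS, norm_inner_symm])
      (norm_sq_le_of_norm_inner_eq hTS hC hS) i)

theorem maxMin_norm_sq_adjoint [FiniteDimensional 𝕜 E] [FiniteDimensional 𝕜 F] (A : E →ₗ[𝕜] F)
    (i : ℕ) : maxMin 𝕜 (fun y => ‖A.adjoint y‖ ^ 2) i = maxMin 𝕜 (fun x => ‖A x‖ ^ 2) i :=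
  maxMin_norm_sq_eq (fun y x => by rw [LinearMap.adjoint_inner_left])
    (sq_nonneg ‖A.toContinuousLinearMap‖) (fun x => by
      rw [← mul_pow]
      exact pow_le_pow_left₀ (norm_nonneg _) (A.toContinuousLinearMap.le_opNorm x) 2) i

end AdjointPair

section Frame

variable {ι : Type*} [Fintype ι]

/-- The conjugate-linear synthesis map `x ↦ ∑ k, conj (x k) • u k` of a finite family `u`. Its
adjoint is the analysis map `y ↦ (⟪y, u k⟫)ₖ`. -/
noncomputable def conjSynthesis (u : ι → E) : EuclideanSpace 𝕜 ι →ₗ⋆[𝕜] E where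
  toFun x := ∑ k, conj (x k) • u k
  map_add' x y := by simp [add_smul, Finset.sum_add_distrib]
  map_smul' a x := by simp [mul_smul, Finset.smul_sum]

theorem conjSynthesis_apply (u : ι → E) (x : EuclideanSpace 𝕜 ι) :
    conjSynthesis u x = ∑ k, conj (x k) • u k :=
  rfl

theorem sum_norm_sq_inner_le (u : ι → E) (y : E) :
    ∑ k, ‖⟪u k, y⟫_𝕜‖ ^ 2 ≤ (∑ k, ‖u k‖ ^ 2) * ‖y‖ ^ 2 := by
  rw [Finset.sum_mul]
  gcongr with k
  rw [← mul_pow]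
  exact pow_le_pow_left₀ (norm_nonneg _) (norm_inner_le_norm _ _) 2

theorem maxMin_sum_norm_sq_inner (u : ι → E) (i : ℕ) :
    maxMin 𝕜 (fun y => ∑ k, ‖⟪u k, y⟫_𝕜‖ ^ 2) i =
      maxMin 𝕜 (fun x : EuclideanSpace 𝕜 ι => ‖conjSynthesis u x‖ ^ 2) i := by
  let analysis : E →ₗ⋆[𝕜] EuclideanSpace 𝕜 ι :=
    { toFun y := WithLp.toLp 2 fun k => ⟪y, u k⟫_𝕜
      map_add' x y := by ext; simp [inner_add_left]
      map_smul' a x := by ext; simp [inner_smul_left] }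
  have hadj : ∀ x y, ‖⟪conjSynthesis u x, y⟫_𝕜‖ = ‖⟪x, analysis y⟫_𝕜‖ := fun x y => by
    rw [conjSynthesis_apply, ← RCLike.norm_conj ⟪x, _⟫_𝕜]
    simp [sum_inner, inner_smul_left, PiLp.inner_apply, analysis, mul_comm]
  have hnorm : ∀ y, ‖analysis y‖ ^ 2 = ∑ k, ‖⟪u k, y⟫_𝕜‖ ^ 2 := fun y => by
    simp [EuclideanSpace.norm_sq_eq, analysis, norm_inner_symm]
  simp only [← hnorm]
  exact (maxMin_norm_sq_eq hadj (Finset.sum_nonneg fun k _ => sq_nonneg ‖u k‖)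
    (fun y => (hnorm y).trans_le (sum_norm_sq_inner_le u y)) i).symm

end Frame

end MaxMin

section RankOneAverage

open scoped TensorProduct

variable {𝕜 H : Type*} [RCLike 𝕜] [NormedAddCommGroup H] [InnerProductSpace 𝕜 H]

section TensorOperator

variable {F : Type*} [NormedAddCommGroup F] [InnerProductSpace 𝕜 F] (J : H →ₗᵢ⋆[𝕜] F)

/-- The operator `y ↦ ∑ j, ⟪J y, z j⟫ • x j` represented by the tensor `∑ j, x j ⊗ₜ z j`, where
`J` embeds `H` into a conjugate copy `F`. The norm of the tensor is the Hilbert–Schmidt norm of the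
operator. -/
noncomputable def tensorOperator : H ⊗[𝕜] F →ₗ[𝕜] (H →L[𝕜] H) :=
  TensorProduct.lift (LinearMap.mk₂ 𝕜
    (fun x z => ((innerSLFlip 𝕜 z).comp J.toContinuousLinearMap).smulRight x)
    (fun x y z => by ext; simp) (fun a x z => by ext y; exact smul_comm _ _ _)
    (fun x z w => by ext; simp [add_smul]) (fun a x z => by ext; simp [mul_smul]))

theorem tensorOperator_tmul_apply (x y : H) (z : F) :
    tensorOperator J (x ⊗ₜ z) y = ⟪J y, z⟫_𝕜 • x :=
  rfl

theorem inner_tensorOperator_apply (x y : H) (t : H ⊗[𝕜] F) :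
    ⟪x, tensorOperator J t y⟫_𝕜 = ⟪x ⊗ₜ[𝕜] J y, t⟫_𝕜 := by
  induction t with
  | zero => simp
  | tmul w z => rw [TensorProduct.inner_tmul, tensorOperator_tmul_apply, inner_smul_right, mul_comm]
  | add s t hs ht => rw [map_add, add_apply, inner_add_right, hs, ht, inner_add_right]

theorem norm_tensorOperator_le (t : H ⊗[𝕜] F) : ‖tensorOperator J t‖ ≤ ‖t‖ := by
  refine ContinuousLinearMap.opNorm_le_of_re_inner_le (𝕜 := 𝕜) (norm_nonneg t) fun y x hy hx => ?_
  rw [inner_re_symm (𝕜 := 𝕜), inner_tensorOperator_apply]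
  refine (re_inner_le_norm _ _).trans_eq ?_
  rw [TensorProduct.norm_tmul, J.norm_map, hx, hy, one_mul, one_mul]

end TensorOperator

open UniformSpace

variable [CompleteSpace H]

/-- The inner product on the dual of a Hilbert space that makes the conjugate-linear Riesz map
`toDual` isometric: `⟪toDual x, toDual y⟫ = ⟪y, x⟫`. -/
@[reducible]
noncomputable def dualInnerProductSpace : InnerProductSpace 𝕜 (StrongDual 𝕜 H) where
  inner ℓ m := m ((toDual 𝕜 H).symm ℓ)
  norm_sq_eq_re_inner ℓ := by
    rw [← toDual_symm_apply, ← norm_sq_eq_re_inner, LinearIsometryEquiv.norm_map]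
  conj_inner_symm ℓ m := by simp only [← toDual_symm_apply, inner_conj_symm]
  add_left ℓ₁ ℓ₂ m := by rw [map_add, map_add]
  smul_left ℓ m a := by rw [LinearIsometryEquiv.map_smulₛₗ, map_smul, smul_eq_mul]

attribute [local instance] dualInnerProductSpace

theorem inner_toDual (x : H) (m : StrongDual 𝕜 H) : ⟪toDual 𝕜 H x, m⟫_𝕜 = m x := by
  change m ((toDual 𝕜 H).symm (toDual 𝕜 H x)) = m x
  rw [LinearIsometryEquiv.symm_apply_apply]

variable (K : H →ₗᵢ[𝕜] H) (f : H)

/-- The time averages `n⁻¹ ∑_{k<n} K^k f ⊗ (K^k f)*` of the rank-one operators along the orbit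
of `f`. -/
noncomputable def rankOneAverage (n : ℕ) : H →L[𝕜] H :=
  birkhoffAverage 𝕜 K (fun x => rankOne 𝕜 x x) n f

theorem birkhoffAverage_of_semiconj {α β V : Type*} [AddCommGroup V] [Module 𝕜 V] {S : α → α}
    {T : β → β} {h : α → β} (hST : Function.Semiconj h S T) (g : β → V) (n : ℕ) (x : α) :
    birkhoffAverage 𝕜 T g n (h x) = birkhoffAverage 𝕜 S (g ∘ h) n x := by
  simp only [birkhoffAverage, birkhoffSum, Function.comp_apply, (hST.iterate_right _).eq]

theorem cauchySeq_birkhoffAverage {X : Type*} [NormedAddCommGroup X] [InnerProductSpace 𝕜 X]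
    (U : X →ₗᵢ[𝕜] X) (x : X) : CauchySeq (birkhoffAverage 𝕜 U id · x) := by
  let V : Completion X →L[𝕜] Completion X := U.toContinuousLinearMap.completion
  have hUV : Function.Semiconj ((↑) : X → Completion X) U V := fun x =>
    (ContinuousLinearMap.completion_apply_coe U.toContinuousLinearMap x).symm
  have hV : ‖V‖ ≤ 1 := by
    refine ContinuousLinearMap.opNorm_le_bound _ zero_le_one fun y => ?_
    induction y using Completion.induction_on with
    | hp => exact isClosed_le (by fun_prop) (by fun_prop)
    | ih y => rw [← hUV y, Completion.norm_coe, Completion.norm_coe, U.norm_map, one_mul]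
  have hcoe : ∀ n, birkhoffAverage 𝕜 V id n x = birkhoffAverage 𝕜 U id n x := fun n => by
    rw [birkhoffAverage_of_semiconj hUV]
    exact (map_birkhoffAverage 𝕜 𝕜 (Completion.toComplₗᵢ (𝕜 := 𝕜) (E := X)) U id n x).symm
  have hlim := V.tendsto_birkhoffAverage_orthogonalProjection hV x
  simp only [hcoe] at hlim
  exact ((Completion.isUniformInducing_coe X).cauchy_map_iff (F := map _ atTop)).1 hlim.cauchySeq

theorem exists_tendsto_rankOneAverage :
    ∃ L : H →L[𝕜] H, Tendsto (rankOneAverage K f) atTop (𝓝 L) := by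
  let dualK : StrongDual 𝕜 H →ₗᵢ[𝕜] StrongDual 𝕜 H :=
    ((toDual 𝕜 H).toLinearIsometry.comp K).comp (toDual 𝕜 H).symm.toLinearIsometry
  let op := tensorOperator (toDual 𝕜 H).toLinearIsometry
  have hsemi : Function.Semiconj (fun x => x ⊗ₜ[𝕜] toDual 𝕜 H x) K
      (TensorProduct.mapIsometry K dualK) := fun x => by
    change _ = K x ⊗ₜ toDual 𝕜 H (K ((toDual 𝕜 H).symm (toDual 𝕜 H x)))
    rw [LinearIsometryEquiv.symm_apply_apply]
  have hop : ∀ n, op (birkhoffAverage 𝕜 (TensorProduct.mapIsometry K dualK) id n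
      (f ⊗ₜ[𝕜] toDual 𝕜 H f)) = rankOneAverage K f n := fun n => by
    rw [birkhoffAverage_of_semiconj hsemi, map_birkhoffAverage 𝕜 𝕜]
    refine congrArg (birkhoffAverage 𝕜 K · n f) (funext fun x => ?_)
    ext y
    change ⟪toDual 𝕜 H y, toDual 𝕜 H x⟫_𝕜 • x = ⟪x, y⟫_𝕜 • x
    rw [inner_toDual, toDual_apply_apply]
  have hcauchy := (cauchySeq_birkhoffAverage (TensorProduct.mapIsometry K dualK)
    (f ⊗ₜ[𝕜] toDual 𝕜 H f)).map (op.mkContinuous 1 fun t =>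
      (norm_tensorOperator_le _ t).trans_eq (one_mul _).symm).uniformContinuous
  exact cauchySeq_tendsto_of_complete ((funext hop : _ = rankOneAverage K f) ▸ hcauchy)

end RankOneAverage

section Eigenvectors

variable {𝕜 H : Type*} [RCLike 𝕜] [NormedAddCommGroup H] [InnerProductSpace 𝕜 H]
  {K : H →ₗᵢ[𝕜] H} {w : H} {z : 𝕜}

theorem norm_iterate_apply (x : H) (k : ℕ) : ‖K^[k] x‖ = ‖x‖ := by
  induction k generalizing x with
  | zero => rfl
  | succ k ih => rw [Function.iterate_succ_apply, ih, K.norm_map]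

theorem norm_eigenvalue_eq_one (hw : w ≠ 0) (hwz : K w = z • w) : ‖z‖ = 1 := by
  have hnorm := K.norm_map w
  rwa [hwz, norm_smul, mul_eq_right₀ (norm_ne_zero_iff.2 hw)] at hnorm

theorem inner_map_of_eigenvector (hwz : K w = z • w) (x : H) : ⟪w, K x⟫_𝕜 = z * ⟪w, x⟫_𝕜 := by
  rcases eq_or_ne w 0 with rfl | hw
  · simp only [inner_zero_left, mul_zero]
  · rw [← K.inner_map_map w x, hwz, inner_smul_left, ← mul_assoc, RCLike.mul_conj,
      norm_eigenvalue_eq_one hw hwz, RCLike.ofReal_one, one_pow, one_mul]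

theorem norm_inner_iterate_of_eigenvector (hwz : K w = z • w) (x : H) (k : ℕ) :
    ‖⟪K^[k] x, w⟫_𝕜‖ = ‖⟪x, w⟫_𝕜‖ := by
  rcases eq_or_ne w 0 with rfl | hw
  · simp only [inner_zero_right]
  induction k generalizing x with
  | zero => rfl
  | succ k ih =>
    rw [Function.iterate_succ_apply, ih, norm_inner_symm, inner_map_of_eigenvector hwz, norm_mul,
      norm_eigenvalue_eq_one hw hwz, one_mul, norm_inner_symm]

theorem inner_eq_zero_of_eigenvalue_ne {v : H} {ξ : 𝕜} (hvξ : K v = ξ • v) (hwz : K w = z • w)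
    (hne : ξ ≠ z) : ⟪v, w⟫_𝕜 = 0 := by
  have hmul : ξ * ⟪v, w⟫_𝕜 = z * ⟪v, w⟫_𝕜 := by
    rw [← inner_map_of_eigenvector hvξ, hwz, inner_smul_right]
  exact (mul_eq_mul_right_iff.1 hmul).resolve_left hne

theorem rankOne_apply_map_of_eigenvector (hwz : K w = z • w) (x : H) :
    rankOne 𝕜 w w (K x) = K (rankOne 𝕜 w w x) := by
  rw [rankOne_apply, rankOne_apply, inner_map_of_eigenvector hwz, map_smul, hwz, smul_smul,
    mul_comm]

end Eigenvectors

section RankOneLimit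

variable {𝕜 H : Type*} [RCLike 𝕜] [NormedAddCommGroup H] [InnerProductSpace 𝕜 H]
  {K : H →ₗᵢ[𝕜] H} {f : H}

theorem rankOneAverage_apply (n : ℕ) (y : H) :
    rankOneAverage K f n y = (n : 𝕜)⁻¹ • ∑ k ∈ Finset.range n, ⟪K^[k] f, y⟫_𝕜 • K^[k] f := by
  simp only [rankOneAverage, birkhoffAverage, birkhoffSum, smul_apply, sum_apply, rankOne_apply]

theorem inner_rankOneAverage_self (n : ℕ) (y : H) :
    ⟪y, rankOneAverage K f n y⟫_𝕜
      = (((n : ℝ)⁻¹ * ∑ k ∈ Finset.range n, ‖⟪K^[k] f, y⟫_𝕜‖ ^ 2 : ℝ) : 𝕜) := by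
  simp only [rankOneAverage_apply, inner_smul_right, inner_sum]
  push_cast
  simp only [← RCLike.mul_conj, inner_conj_symm]

theorem abs_average_norm_sq_inner_sub_re_inner_le (L : H →L[𝕜] H) (n : ℕ) (y : H) :
    |(n : ℝ)⁻¹ * ∑ k ∈ Finset.range n, ‖⟪K^[k] f, y⟫_𝕜‖ ^ 2 - RCLike.re ⟪y, L y⟫_𝕜|
      ≤ ‖rankOneAverage K f n - L‖ * ‖y‖ ^ 2 := by
  have hre := congrArg RCLike.re (inner_rankOneAverage_self (𝕜 := 𝕜) (K := K) (f := f) n y)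
  rw [RCLike.ofReal_re] at hre
  rw [← hre, ← map_sub, ← inner_sub_right, ← sub_apply]
  calc |RCLike.re ⟪y, (rankOneAverage K f n - L) y⟫_𝕜|
      ≤ ‖y‖ * ‖(rankOneAverage K f n - L) y‖ :=
        (RCLike.abs_re_le_norm _).trans (norm_inner_le_norm _ _)
    _ ≤ ‖y‖ * (‖rankOneAverage K f n - L‖ * ‖y‖) := by
        gcongr
        exact ContinuousLinearMap.le_opNorm _ _
    _ = ‖rankOneAverage K f n - L‖ * ‖y‖ ^ 2 := by ring

theorem isSymmetric_rankOneAverage (n : ℕ) : (rankOneAverage K f n : H →ₗ[𝕜] H).IsSymmetric :=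
  fun x y => by
    simp only [ContinuousLinearMap.coe_coe, rankOneAverage_apply, inner_smul_left, inner_smul_right,
      sum_inner, inner_sum, inner_conj_symm, map_inv₀, map_natCast, mul_comm]

theorem rankOne_mem_compactOperator (x y : H) :
    rankOne 𝕜 x y ∈ compactOperator (RingHom.id 𝕜) H H :=
  (isCompactOperator_of_locallyCompactSpace_dom (innerSL 𝕜 y)).clm_comp (.toSpanSingleton 𝕜 x)

theorem isCompactOperator_rankOneAverage (n : ℕ) : IsCompactOperator (rankOneAverage K f n) :=
  (compactOperator (RingHom.id 𝕜) H H).smul_mem _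
    (Submodule.sum_mem _ fun _ _ => rankOne_mem_compactOperator _ _)

theorem rankOneAverage_map_apply_map (n : ℕ) (y : H) :
    rankOneAverage K (K f) n (K y) = K (rankOneAverage K f n y) := by
  simp only [rankOneAverage_apply, ← Function.iterate_succ_apply, Function.iterate_succ_apply',
    K.inner_map_map, map_smul, map_sum]

theorem tendsto_rankOneAverage_map {L : H →L[𝕜] H}
    (hL : Tendsto (rankOneAverage K f) atTop (𝓝 L)) :
    Tendsto (rankOneAverage K (K f)) atTop (𝓝 L) := by
  have hbounded : Bornology.IsBounded (Set.range fun k => rankOne 𝕜 (K^[k] f) (K^[k] f)) := by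
    refine isBounded_iff_forall_norm_le.2 ⟨‖f‖ * ‖f‖, ?_⟩
    rintro _ ⟨k, rfl⟩
    rw [norm_rankOne, norm_iterate_apply]
  have hdiff := tendsto_birkhoffAverage_apply_sub_birkhoffAverage (g := fun x => rankOne 𝕜 x x) 𝕜
    hbounded
  exact (zero_add L ▸ hdiff.add hL).congr fun n => sub_add_cancel _ _

variable {L : H →L[𝕜] H} (hL : Tendsto (rankOneAverage K f) atTop (𝓝 L))

include hL

theorem tendsto_rankOneAverage_apply (y : H) :
    Tendsto (fun n => rankOneAverage K f n y) atTop (𝓝 (L y)) :=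
  ((ContinuousLinearMap.apply 𝕜 H y).continuous.tendsto L).comp hL

theorem isSymmetric_of_tendsto_rankOneAverage : (L : H →ₗ[𝕜] H).IsSymmetric := fun x y =>
  tendsto_nhds_unique ((tendsto_rankOneAverage_apply hL x).inner tendsto_const_nhds) <|
    (tendsto_const_nhds.inner (tendsto_rankOneAverage_apply hL y)).congr fun n =>
      (isSymmetric_rankOneAverage n x y).symm

theorem map_apply_of_tendsto_rankOneAverage (y : H) : L (K y) = K (L y) :=
  tendsto_nhds_unique (tendsto_rankOneAverage_apply (tendsto_rankOneAverage_map hL) (K y)) <|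
    ((K.continuous.tendsto _).comp (tendsto_rankOneAverage_apply hL y)).congr fun n =>
      (rankOneAverage_map_apply_map n y).symm

theorem inner_self_of_tendsto_rankOneAverage {w : H} {z : 𝕜} (hwz : K w = z • w) :
    ⟪w, L w⟫_𝕜 = ((‖⟪f, w⟫_𝕜‖ ^ 2 : ℝ) : 𝕜) := by
  refine tendsto_nhds_unique (tendsto_const_nhds.inner (tendsto_rankOneAverage_apply hL w))
    (tendsto_const_nhds.congr' ?_)
  filter_upwards [eventually_ne_atTop 0] with n hn
  simp only [inner_rankOneAverage_self, norm_inner_iterate_of_eigenvector hwz, Finset.sum_const,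
    Finset.card_range, nsmul_eq_mul]
  rw [inv_mul_cancel_left₀ (Nat.cast_ne_zero.2 hn)]

variable [CompleteSpace H]

theorem isCompactOperator_of_tendsto_rankOneAverage : IsCompactOperator L :=
  isCompactOperator_of_tendsto hL (.of_forall isCompactOperator_rankOneAverage)

end RankOneLimit

section Rigidity

variable {H : Type*} [NormedAddCommGroup H] [InnerProductSpace ℂ H] {K : H →ₗᵢ[ℂ] H}

theorem exists_eigenvector_mem_of_map_mem {V : Submodule ℂ H} [FiniteDimensional ℂ V] (hV : V ≠ ⊥)
    (hKV : ∀ x ∈ V, K x ∈ V) : ∃ w ∈ V, w ≠ 0 ∧ ∃ z : ℂ, K w = z • w := by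
  have := Submodule.nontrivial_iff_ne_bot.2 hV
  obtain ⟨z, hz⟩ := Module.End.exists_eigenvalue (K.toLinearMap.restrict hKV)
  obtain ⟨w, hw⟩ := hz.exists_hasEigenvector
  exact ⟨w, w.2, fun h => hw.2 (Subtype.ext h), z, congrArg Subtype.val hw.apply_eq_smul⟩

theorem eq_zero_of_forall_eigenvector_inner_eq_zero [CompleteSpace H] {D : H →L[ℂ] H}
    (hcompact : IsCompactOperator D) (hsymm : (D : H →ₗ[ℂ] H).IsSymmetric)
    (hcomm : ∀ x, D (K x) = K (D x)) (hD : ∀ w (z : ℂ), K w = z • w → ⟪w, D w⟫_ℂ = 0) : D = 0 := by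
  refine (ContinuousLinearMap.eq_zero_of_forall_hasEigenvalue_eq_zero hcompact hsymm).1
    fun μ hμ => by_contra fun hμ0 => ?_
  have := ContinuousLinearMap.finite_dimensional_eigenspace hcompact μ hμ0
  obtain ⟨w, hwμ, hw0, z, hwz⟩ := exists_eigenvector_mem_of_map_mem (K := K) hμ fun x hx => by
    rw [Module.End.mem_eigenspace_iff, ContinuousLinearMap.coe_coe] at hx ⊢
    rw [hcomm, hx, map_smul]
  have hDw : D w = μ • w := Module.End.mem_eigenspace_iff.1 hwμ
  have hzero := hD w z hwz
  rw [hDw, inner_smul_right] at hzero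
  exact mul_ne_zero hμ0 (inner_self_ne_zero.2 hw0) hzero

end Rigidity

section EigenvectorExpansion

variable {𝕜 H : Type*} [RCLike 𝕜] [NormedAddCommGroup H] [InnerProductSpace 𝕜 H]

/-- `f = ∑ i, a i • v i + r` is the expansion of `f` in eigenvectors of the isometry `K`: the
`v i` with `a i ≠ 0` are unit eigenvectors with distinct eigenvalues `ξ i`, the remainder `r` is
orthogonal to all eigenvectors, and the `‖a i‖` decrease. Nothing is required of `v i` and `ξ i`
when `a i = 0`. -/
structure IsEigenvectorExpansion (K : H →ₗᵢ[𝕜] H) (f : H) (a ξ : ℕ → 𝕜) (v : ℕ → H) (r : H) :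
    Prop where
  norm_eq_one : ∀ i, a i ≠ 0 → ‖v i‖ = 1
  eigen : ∀ i, a i ≠ 0 → K (v i) = ξ i • v i
  distinct : ∀ i j, a i ≠ 0 → a j ≠ 0 → i ≠ j → ξ i ≠ ξ j
  remainder_orthogonal : ∀ (z : 𝕜) (w : H), K w = z • w → ⟪w, r⟫_𝕜 = 0
  hasSum : HasSum (fun i => a i • v i) (f - r)
  antitone : Antitone fun i => ‖a i‖

/-- The operator `∑ i, ‖a i‖ ^ 2 • v i ⊗ (v i)*`; it is the limit of `rankOneAverage` when the
`a i` and `v i` are the coefficients and the vectors of an expansion in eigenvectors. -/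
noncomputable def expansionOperator (a : ℕ → 𝕜) (v : ℕ → H) : H →L[𝕜] H :=
  ∑' i, ((‖a i‖ ^ 2 : ℝ) : 𝕜) • rankOne 𝕜 (v i) (v i)

namespace IsEigenvectorExpansion

variable {K : H →ₗᵢ[𝕜] H} {f r : H} {a ξ : ℕ → 𝕜} {v : ℕ → H}
  (h : IsEigenvectorExpansion K f a ξ v r)

include h

theorem inner_eq_zero {i j : ℕ} (hi : a i ≠ 0) (hj : a j ≠ 0) (hij : i ≠ j) : ⟪v i, v j⟫_𝕜 = 0 :=
  inner_eq_zero_of_eigenvalue_ne (h.eigen i hi) (h.eigen j hj) (h.distinct i j hi hj hij)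

theorem orthonormal : Orthonormal 𝕜 fun j : {j // ‖a j‖ ^ 2 ≠ 0} => v j := by
  have hne : ∀ j : {j // ‖a j‖ ^ 2 ≠ 0}, a j ≠ 0 := fun j =>
    norm_ne_zero_iff.1 (ne_zero_pow two_ne_zero j.2)
  exact ⟨fun i => h.norm_eq_one i (hne i), fun i j hij =>
    h.inner_eq_zero (hne i) (hne j) fun heq => hij (Subtype.ext heq)⟩

theorem inner_of_eigenvector {w : H} {z : 𝕜} (hwz : K w = z • w) :
    HasSum (fun i => a i * ⟪w, v i⟫_𝕜) ⟪w, f⟫_𝕜 := by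
  simpa only [innerSL_apply_apply, inner_sub_right, inner_smul_right,
    h.remainder_orthogonal z w hwz, sub_zero] using (innerSL 𝕜 w).hasSum h.hasSum

theorem inner_eq_coeff {i : ℕ} (hi : a i ≠ 0) : ⟪v i, f⟫_𝕜 = a i := by
  refine (h.inner_of_eigenvector (h.eigen i hi)).unique ?_
  convert hasSum_single i fun j hji => ?_ using 1
  · rw [inner_self_eq_norm_sq_to_K, h.norm_eq_one i hi, RCLike.ofReal_one, one_pow, mul_one]
  · rcases eq_or_ne (a j) 0 with hj | hj
    · rw [hj, zero_mul]
    · rw [h.inner_eq_zero hi hj hji.symm, mul_zero]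

theorem summable_norm_sq : Summable fun i => ‖a i‖ ^ 2 := by
  have hsum := (innerSL 𝕜 (f - r)).hasSum h.hasSum
  have hcoeff : ∀ i, ⟪f - r, a i • v i⟫_𝕜 = ((‖a i‖ ^ 2 : ℝ) : 𝕜) := fun i => by
    rcases eq_or_ne (a i) 0 with hi | hi
    · simp only [hi, zero_smul, inner_zero_right, norm_zero, ne_eq, two_ne_zero, not_false_eq_true,
        zero_pow, RCLike.ofReal_zero]
    · rw [inner_smul_right, ← inner_conj_symm, inner_sub_right, h.inner_eq_coeff hi,
        h.remainder_orthogonal _ _ (h.eigen i hi), sub_zero, RCLike.mul_conj, RCLike.ofReal_pow]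
  simp only [innerSL_apply_apply, hcoeff] at hsum
  exact (RCLike.summable_ofReal 𝕜).1 hsum.summable

/-- At most one eigenvalue `ξ i` is the eigenvalue of `w`, and the other `v i` are orthogonal to
`w`: both sides come from a single index. -/
theorem hasSum_norm_sq_mul_norm_sq_inner {w : H} {z : 𝕜} (hwz : K w = z • w) :
    HasSum (fun i => ‖a i‖ ^ 2 * ‖⟪v i, w⟫_𝕜‖ ^ 2) (‖⟪f, w⟫_𝕜‖ ^ 2) := by
  obtain ⟨i, hi⟩ : ∃ i, ∀ j ≠ i, a j = 0 ∨ ⟪w, v j⟫_𝕜 = 0 := by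
    by_cases hz : ∃ i, a i ≠ 0 ∧ ξ i = z
    · obtain ⟨i, hi, rfl⟩ := hz
      refine ⟨i, fun j hji => or_iff_not_imp_left.2 fun hj => ?_⟩
      exact inner_eq_zero_of_eigenvalue_ne hwz (h.eigen j hj) (h.distinct i j hi hj hji.symm)
    · refine ⟨0, fun j _ => or_iff_not_imp_left.2 fun hj => ?_⟩
      exact inner_eq_zero_of_eigenvalue_ne hwz (h.eigen j hj) fun hzj => hz ⟨j, hj, hzj.symm⟩
  have hwf : ⟪w, f⟫_𝕜 = a i * ⟪w, v i⟫_𝕜 :=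
    (h.inner_of_eigenvector hwz).unique <| hasSum_single i fun j hji => mul_eq_zero.2 (hi j hji)
  rw [norm_inner_symm, hwf, norm_mul, mul_pow, norm_inner_symm w]
  refine hasSum_single i fun j hji => ?_
  rw [norm_inner_symm, ← mul_pow, ← norm_mul, mul_eq_zero.2 (hi j hji), norm_zero,
    zero_pow two_ne_zero]

variable [CompleteSpace H]

theorem hasSum_expansionOperator :
    HasSum (fun i => ((‖a i‖ ^ 2 : ℝ) : 𝕜) • rankOne 𝕜 (v i) (v i)) (expansionOperator a v) := by
  refine (h.summable_norm_sq.of_norm_bounded fun i => ?_).hasSum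
  rcases eq_or_ne (a i) 0 with hi | hi
  · simp only [hi, norm_zero, ne_eq, two_ne_zero, not_false_eq_true, zero_pow, RCLike.ofReal_zero,
      zero_smul, le_refl]
  · rw [norm_smul, norm_rankOne, h.norm_eq_one i hi, mul_one, mul_one, RCLike.norm_ofReal,
      abs_of_nonneg (sq_nonneg _)]

theorem hasSum_expansionOperator_apply (y : H) :
    HasSum (fun i => ((‖a i‖ ^ 2 : ℝ) : 𝕜) • rankOne 𝕜 (v i) (v i) y)
      (expansionOperator a v y) := by
  simpa only [ContinuousLinearMap.apply_apply, smul_apply] using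
    (ContinuousLinearMap.apply 𝕜 H y).hasSum h.hasSum_expansionOperator

theorem hasSum_inner_expansionOperator (x y : H) :
    HasSum (fun i => ((‖a i‖ ^ 2 : ℝ) : 𝕜) * (⟪x, v i⟫_𝕜 * ⟪v i, y⟫_𝕜))
      ⟪x, expansionOperator a v y⟫_𝕜 := by
  simpa only [innerSL_apply_apply, rankOne_apply, inner_smul_right, mul_comm ⟪v _, y⟫_𝕜] using
    (innerSL 𝕜 x).hasSum (h.hasSum_expansionOperator_apply y)

theorem hasSum_inner_expansionOperator_self (y : H) :
    HasSum (fun i => ‖a i‖ ^ 2 * ‖⟪v i, y⟫_𝕜‖ ^ 2) (RCLike.re ⟪y, expansionOperator a v y⟫_𝕜) := by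
  refine (RCLike.hasSum_re 𝕜 (h.hasSum_inner_expansionOperator y y)).congr_fun fun i => ?_
  rw [RCLike.re_ofReal_mul, ← inner_conj_symm, RCLike.mul_conj, RCLike.norm_conj,
    ← RCLike.ofReal_pow, RCLike.ofReal_re]

theorem isCompactOperator_expansionOperator : IsCompactOperator (expansionOperator a v) :=
  isCompactOperator_of_tendsto (l := atTop) h.hasSum_expansionOperator <| .of_forall fun _ =>
    (compactOperator (RingHom.id 𝕜) H H).sum_mem fun _ _ =>
      Submodule.smul_mem _ _ (rankOne_mem_compactOperator _ _)

theorem isSymmetric_expansionOperator : (expansionOperator a v : H →ₗ[𝕜] H).IsSymmetric := by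
  intro x y
  refine HasSum.unique ?_ (h.hasSum_inner_expansionOperator x y)
  simpa only [ContinuousLinearMap.coe_coe, map_mul, inner_conj_symm, RCLike.conj_ofReal,
    mul_comm ⟪v _, y⟫_𝕜] using
    (RCLike.hasSum_conj' 𝕜).2 (h.hasSum_inner_expansionOperator y x)

theorem expansionOperator_map (y : H) :
    expansionOperator a v (K y) = K (expansionOperator a v y) := by
  refine (h.hasSum_expansionOperator_apply (K y)).unique ?_
  convert! K.toContinuousLinearMap.hasSum (h.hasSum_expansionOperator_apply y) using 2 with i
  rcases eq_or_ne (a i) 0 with hi | hi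
  · simp [hi]
  · simp [rankOne_apply_map_of_eigenvector (h.eigen i hi)]

end IsEigenvectorExpansion

end EigenvectorExpansion

section SpectralLimit

variable {H : Type*} [NormedAddCommGroup H] [InnerProductSpace ℂ H] [CompleteSpace H]
  {K : H →ₗᵢ[ℂ] H} {f r : H} {a ξ : ℕ → ℂ} {v : ℕ → H}

namespace IsEigenvectorExpansion

theorem tendsto_rankOneAverage (h : IsEigenvectorExpansion K f a ξ v r) :
    Tendsto (rankOneAverage K f) atTop (𝓝 (expansionOperator a v)) := by
  obtain ⟨L, hL⟩ := exists_tendsto_rankOneAverage K f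
  suffices hzero : L - expansionOperator a v = 0 from sub_eq_zero.1 hzero ▸ hL
  refine eq_zero_of_forall_eigenvector_inner_eq_zero (K := K)
    ((isCompactOperator_of_tendsto_rankOneAverage hL).sub h.isCompactOperator_expansionOperator)
    ((isSymmetric_of_tendsto_rankOneAverage hL).sub h.isSymmetric_expansionOperator)
    (fun x => ?_) fun w z hwz => ?_
  · rw [sub_apply, sub_apply, map_apply_of_tendsto_rankOneAverage hL, h.expansionOperator_map,
      map_sub]
  · have hre := (h.hasSum_inner_expansionOperator_self w).unique
      (h.hasSum_norm_sq_mul_norm_sq_inner hwz)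
    have hreal : ((RCLike.re ⟪w, expansionOperator a v w⟫_ℂ : ℝ) : ℂ) =
        ⟪w, expansionOperator a v w⟫_ℂ :=
      h.isSymmetric_expansionOperator.coe_re_inner_self_apply w
    rw [sub_apply, inner_sub_right, inner_self_of_tendsto_rankOneAverage hL hwz, ← hreal, hre]
    exact sub_self _

theorem tendsto_maxMin_orbit (h : IsEigenvectorExpansion K f a ξ v r) (i : ℕ) :
    Tendsto (fun n : ℕ => (n : ℝ)⁻¹ * maxMin ℂ (fun x : EuclideanSpace ℂ (Fin n) =>
      ‖conjSynthesis (𝕜 := ℂ) (fun k : Fin n => K^[k] f) x‖ ^ 2) i) atTop (𝓝 (‖a i‖ ^ 2)) := by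
  have hvalue : maxMin ℂ (fun y => RCLike.re ⟪y, expansionOperator a v y⟫_ℂ) i = ‖a i‖ ^ 2 :=
    maxMin_eq_of_hasSum (fun i j hij => pow_le_pow_left₀ (norm_nonneg _) (h.antitone hij) 2)
      (fun _ => sq_nonneg _) h.orthonormal h.hasSum_inner_expansionOperator_self i
  have hlim : Tendsto (fun n : ℕ => maxMin ℂ
      (fun y => (n : ℝ)⁻¹ * ∑ k ∈ Finset.range n, ‖⟪K^[k] f, y⟫_ℂ‖ ^ 2) i) atTop
      (𝓝 (maxMin ℂ (fun y => RCLike.re ⟪y, expansionOperator a v y⟫_ℂ) i)) := by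
    refine tendsto_maxMin (C := ‖expansionOperator a v‖) (fun n y => by positivity)
      (fun y => (h.hasSum_inner_expansionOperator_self y).nonneg fun _ => by positivity)
      (fun y => ?_) (tendsto_iff_norm_sub_tendsto_zero.1 h.tendsto_rankOneAverage)
      (abs_average_norm_sq_inner_sub_re_inner_le _) i
    calc RCLike.re ⟪y, expansionOperator a v y⟫_ℂ
        ≤ ‖y‖ * ‖expansionOperator a v y‖ := re_inner_le_norm _ _
      _ ≤ ‖y‖ * (‖expansionOperator a v‖ * ‖y‖) := by
          gcongr
          exact ContinuousLinearMap.le_opNorm _ _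
      _ = ‖expansionOperator a v‖ * ‖y‖ ^ 2 := by ring
  rw [← hvalue]
  refine hlim.congr' ?_
  filter_upwards [eventually_gt_atTop 0] with n hn
  simp only [Finset.sum_range]
  rw [maxMin_const_mul (sum_norm_sq_inner_le _) (fun y => by positivity) (by positivity) i,
    maxMin_sum_norm_sq_inner]

end IsEigenvectorExpansion

end SpectralLimit

section Enumeration

variable {α : Type*} [Infinite α] {φ : α → ℝ}

theorem exists_notMem_forall_notMem_le (hφ : ∀ z, 0 ≤ φ z) (hfin : ∀ ε > 0, {z | ε ≤ φ z}.Finite)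
    (t : Finset α) : ∃ z ∉ t, ∀ w ∉ t, φ w ≤ φ z := by
  by_cases hpos : ∃ z ∉ t, 0 < φ z
  · obtain ⟨z₀, hz₀, hφz₀⟩ := hpos
    obtain ⟨z, ⟨hz, hzt⟩, hmax⟩ := Set.exists_max_image ({z | φ z₀ ≤ φ z} \ ↑t) φ
      ((hfin _ hφz₀).subset Set.sdiff_subset) ⟨z₀, le_refl (φ z₀), hz₀⟩
    refine ⟨z, hzt, fun w hw => ?_⟩
    rcases le_total (φ z₀) (φ w) with hle | hle
    · exact hmax w ⟨hle, hw⟩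
    · exact hle.trans hz
  · obtain ⟨z, hz⟩ := Infinite.exists_notMem_finset t
    exact ⟨z, hz, fun w hw => (not_lt.1 fun hlt => hpos ⟨w, hw, hlt⟩).trans (hφ z)⟩

theorem exists_injective_antitone_comp (hφ : ∀ z, 0 ≤ φ z)
    (hfin : ∀ ε > 0, {z | ε ≤ φ z}.Finite) :
    ∃ s : ℕ → α, Function.Injective s ∧ Antitone (φ ∘ s) ∧ ∀ z, φ z ≠ 0 → z ∈ Set.range s := by
  classical
  choose next hnext hmax using exists_notMem_forall_notMem_le hφ hfin
  let chosen : ℕ → Finset α := fun n => (fun t => insert (next t) t)^[n] ∅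
  have hchosen : ∀ n, chosen (n + 1) = insert (next (chosen n)) (chosen n) := fun n =>
    Function.iterate_succ_apply' _ n ∅
  have hmono : Monotone chosen := monotone_nat_of_le_succ fun n =>
    hchosen n ▸ Finset.subset_insert _ _
  have hmem : ∀ {m n}, m < n → next (chosen m) ∈ chosen n := fun hmn =>
    hmono hmn (hchosen _ ▸ Finset.mem_insert_self _ _)
  have hinj : Function.Injective fun n => next (chosen n) :=
    .of_lt_imp_ne fun m n hmn heq => hnext (chosen n) (heq ▸ hmem hmn)
  refine ⟨fun n => next (chosen n), hinj,
    fun m n hmn => hmax (chosen m) _ fun h => hnext (chosen n) (hmono hmn h), fun z hz => ?_⟩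
  by_contra hrange
  have hz_notMem : ∀ n, z ∉ chosen n := fun n => by
    induction n with
    | zero => exact Finset.notMem_empty z
    | succ n ih =>
      rw [hchosen, Finset.mem_insert, not_or]
      exact ⟨fun heq => hrange ⟨n, heq.symm⟩, ih⟩
  refine Set.infinite_range_of_injective hinj
    ((hfin (φ z) (lt_of_le_of_ne (hφ z) hz.symm)).subset ?_)
  rintro _ ⟨n, rfl⟩
  exact hmax (chosen n) z (hz_notMem n)

end Enumeration

section Eigencomponent

variable {𝕜 H : Type*} [RCLike 𝕜] [NormedAddCommGroup H] [InnerProductSpace 𝕜 H]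

theorem orthogonalFamily_eigenspace (K : H →ₗᵢ[𝕜] H) :
    OrthogonalFamily 𝕜 (fun z => End.eigenspace K.toLinearMap z)
      fun z => (End.eigenspace K.toLinearMap z).subtypeₗᵢ := fun _ _ hne x y =>
  inner_eq_zero_of_eigenvalue_ne (End.mem_eigenspace_iff.1 x.2) (End.mem_eigenspace_iff.1 y.2) hne

variable [CompleteSpace H]

instance hasOrthogonalProjection_eigenspace (K : H →ₗᵢ[𝕜] H) (z : 𝕜) :
    (End.eigenspace K.toLinearMap z).HasOrthogonalProjection := by
  have hclosed : IsClosed (End.eigenspace K.toLinearMap z : Set H) := by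
    convert! isClosed_eq K.continuous (continuous_const_smul z)
    ext x
    exact End.mem_eigenspace_iff
  have := hclosed.completeSpace_coe
  infer_instance

/-- The component of `f` along the eigenspace of `K` for `z`; it is zero when `z` is not an
eigenvalue. -/
noncomputable def eigencomponent (K : H →ₗᵢ[𝕜] H) (f : H) (z : 𝕜) : H :=
  (End.eigenspace K.toLinearMap z).starProjection f

variable {K : H →ₗᵢ[𝕜] H} {f w : H} {z : 𝕜}

theorem map_eigencomponent : K (eigencomponent K f z) = z • eigencomponent K f z :=
  End.mem_eigenspace_iff.1 (Submodule.starProjection_apply_mem _ f)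

theorem inner_sub_eigencomponent (hwz : K w = z • w) : ⟪w, f - eigencomponent K f z⟫_𝕜 = 0 :=
  (Submodule.mem_orthogonal _ _).1 (Submodule.sub_starProjection_mem_orthogonal f) w
    (End.mem_eigenspace_iff.2 hwz)

theorem inner_eigencomponent_self :
    ⟪eigencomponent K f z, f⟫_𝕜 = (‖eigencomponent K f z‖ : 𝕜) ^ 2 := by
  rw [← inner_self_eq_norm_sq_to_K, ← sub_eq_zero, ← inner_sub_right]
  exact inner_sub_eigencomponent map_eigencomponent

variable (K f)

theorem norm_sq_sum_eigencomponent (s : Finset 𝕜) :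
    ‖∑ z ∈ s, eigencomponent K f z‖ ^ 2 = ∑ z ∈ s, ‖eigencomponent K f z‖ ^ 2 :=
  (orthogonalFamily_eigenspace K).norm_sum
    (fun _ => ⟨_, Submodule.starProjection_apply_mem _ f⟩) s

theorem norm_sum_eigencomponent_le (s : Finset 𝕜) : ‖∑ z ∈ s, eigencomponent K f z‖ ≤ ‖f‖ := by
  set g := ∑ z ∈ s, eigencomponent K f z with hg
  have hgf : ⟪g, f⟫_𝕜 = ((‖g‖ ^ 2 : ℝ) : 𝕜) := by
    rw [hg, norm_sq_sum_eigencomponent, sum_inner]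
    push_cast
    exact Finset.sum_congr rfl fun z _ => inner_eigencomponent_self
  have hle : ‖g‖ ^ 2 ≤ ‖g‖ * ‖f‖ := by
    simpa only [hgf, RCLike.norm_ofReal, abs_sq] using norm_inner_le_norm (𝕜 := 𝕜) g f
  rcases (norm_nonneg g).eq_or_lt with hzero | hpos
  · exact hzero ▸ norm_nonneg f
  · exact le_of_mul_le_mul_left (sq ‖g‖ ▸ hle) hpos

theorem summable_norm_sq_eigencomponent : Summable fun z => ‖eigencomponent K f z‖ ^ 2 :=
  summable_of_sum_le (fun _ => sq_nonneg _) fun s =>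
    (norm_sq_sum_eigencomponent K f s).symm.trans_le
      (pow_le_pow_left₀ (norm_nonneg _) (norm_sum_eigencomponent_le K f s) 2)

theorem summable_eigencomponent : Summable (eigencomponent K f) :=
  ((orthogonalFamily_eigenspace K).summable_iff_norm_sq_summable
    fun _ => ⟨_, Submodule.starProjection_apply_mem _ f⟩).2 (summable_norm_sq_eigencomponent K f)

theorem finite_setOf_le_norm_eigencomponent {ε : ℝ} (hε : 0 < ε) :
    {z | ε ≤ ‖eigencomponent K f z‖}.Finite := by
  have hlt := (summable_norm_sq_eigencomponent K f).tendsto_cofinite_zero.eventually_lt_const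
    (pow_pos hε 2)
  exact (eventually_cofinite.1 hlt).subset fun _ hz => not_lt.2 (pow_le_pow_left₀ hε.le hz 2)

theorem inner_sub_tsum_eigencomponent (hwz : K w = z • w) :
    ⟪w, f - ∑' ζ, eigencomponent K f ζ⟫_𝕜 = 0 := by
  have hsum : ⟪w, ∑' ζ, eigencomponent K f ζ⟫_𝕜 = ⟪w, eigencomponent K f z⟫_𝕜 :=
    ((innerSL 𝕜 w).hasSum (summable_eigencomponent K f).hasSum).unique <|
      hasSum_single z fun ζ hζ => inner_eq_zero_of_eigenvalue_ne hwz map_eigencomponent hζ.symm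
  rw [inner_sub_right, hsum, ← inner_sub_right, inner_sub_eigencomponent hwz]

theorem exists_isEigenvectorExpansion :
    ∃ (a ξ : ℕ → 𝕜) (v : ℕ → H) (r : H), IsEigenvectorExpansion K f a ξ v r := by
  obtain ⟨ξ, hξ, hanti, hrange⟩ := exists_injective_antitone_comp
    (fun z => norm_nonneg (eigencomponent K f z))
    fun _ => finite_setOf_le_norm_eigencomponent K f
  have hsum : HasSum (eigencomponent K f ∘ ξ) (∑' z, eigencomponent K f z) :=
    (hξ.hasSum_iff fun z hz => by_contra fun hne => hz (hrange z (norm_ne_zero_iff.2 hne))).2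
      (summable_eigencomponent K f).hasSum
  let a : ℕ → 𝕜 := fun i => ‖eigencomponent K f (ξ i)‖
  let v : ℕ → H := fun i => (a i)⁻¹ • eigencomponent K f (ξ i)
  have hav : ∀ i, a i • v i = eigencomponent K f (ξ i) := fun i => by
    rcases eq_or_ne (eigencomponent K f (ξ i)) 0 with hi | hi
    · simp only [v, hi, smul_zero]
    · exact smul_inv_smul₀ (RCLike.ofReal_ne_zero.2 (norm_ne_zero_iff.2 hi)) _
  refine ⟨a, ξ, v, f - ∑' z, eigencomponent K f z, ?_⟩
  constructor
  case norm_eq_one =>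
    exact fun i hi => norm_smul_inv_norm (norm_ne_zero_iff.1 (RCLike.ofReal_ne_zero.1 hi))
  case eigen => exact fun i _ => by rw [map_smul, map_eigencomponent, smul_comm]
  case distinct => exact fun i j _ _ hij => hξ.ne hij
  case remainder_orthogonal => exact fun _ _ hwz => inner_sub_tsum_eigencomponent K f hwz
  case hasSum => simpa only [sub_sub_cancel, hav] using! hsum
  case antitone => simpa only [a, RCLike.norm_ofReal, abs_norm] using! hanti

end Eigencomponent

section GramLimit

variable {𝕜 ι : Type*} [RCLike 𝕜] [Fintype ι]

theorem norm_sum_sum_mul_le (B : ι → ι → 𝕜) (x : EuclideanSpace 𝕜 ι) :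
    ‖∑ k, ∑ l, x k * conj (x l) * B k l‖ ≤ (∑ k, ∑ l, ‖B k l‖) * ‖x‖ ^ 2 := by
  simp only [Finset.sum_mul]
  refine norm_sum_le_of_le _ fun k _ => norm_sum_le_of_le _ fun l _ => ?_
  rw [norm_mul, norm_mul, RCLike.norm_conj, mul_comm, sq]
  gcongr <;> exact PiLp.norm_apply_le x _

section

variable {E : Type*} [NormedAddCommGroup E] [InnerProductSpace 𝕜 E]

theorem norm_sq_conjSynthesis (u : ι → E) (x : EuclideanSpace 𝕜 ι) :
    ((‖conjSynthesis u x‖ ^ 2 : ℝ) : 𝕜) = ∑ k, ∑ l, x k * conj (x l) * ⟪u k, u l⟫_𝕜 := by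
  rw [RCLike.ofReal_pow, ← inner_self_eq_norm_sq_to_K, conjSynthesis_apply, sum_inner]
  simp only [inner_sum, inner_smul_left, inner_smul_right, RCLike.conj_conj]
  exact Finset.sum_congr rfl fun k _ => Finset.sum_congr rfl fun l _ => by ring

theorem norm_sq_conjSynthesis_le (u : ι → E) (x : EuclideanSpace 𝕜 ι) :
    ‖conjSynthesis u x‖ ^ 2 ≤ (∑ k, ∑ l, ‖⟪u k, u l⟫_𝕜‖) * ‖x‖ ^ 2 := by
  rw [← abs_of_nonneg (sq_nonneg ‖conjSynthesis u x‖), ← RCLike.norm_ofReal (K := 𝕜),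
    norm_sq_conjSynthesis]
  exact norm_sum_sum_mul_le _ x

end

theorem tendsto_maxMin_of_tendsto_inner {α : Type*} {l : Filter α} {E : α → Type*} {E₀ : Type*}
    [∀ n, NormedAddCommGroup (E n)] [∀ n, InnerProductSpace 𝕜 (E n)] [NormedAddCommGroup E₀]
    [InnerProductSpace 𝕜 E₀] {u : ∀ n, ι → E n} {u₀ : ι → E₀} {t : α → ℝ} (ht : ∀ n, 0 ≤ t n)
    (h : ∀ j k, Tendsto (fun n => (t n : 𝕜) * ⟪u n j, u n k⟫_𝕜) l (𝓝 ⟪u₀ j, u₀ k⟫_𝕜)) (i : ℕ) :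
    Tendsto (fun n => maxMin 𝕜 (fun x : EuclideanSpace 𝕜 ι => t n * ‖conjSynthesis (u n) x‖ ^ 2) i)
      l (𝓝 (maxMin 𝕜 (fun x : EuclideanSpace 𝕜 ι => ‖conjSynthesis u₀ x‖ ^ 2) i)) := by
  have hε : Tendsto (fun n => ∑ j, ∑ k, ‖(t n : 𝕜) * ⟪u n j, u n k⟫_𝕜 - ⟪u₀ j, u₀ k⟫_𝕜‖) l
      (𝓝 0) := by
    simpa only [Finset.sum_const_zero] using
      tendsto_finsetSum Finset.univ fun j _ => tendsto_finsetSum Finset.univ fun k _ =>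
        tendsto_iff_norm_sub_tendsto_zero.1 (h j k)
  refine tendsto_maxMin (fun n x => mul_nonneg (ht n) (sq_nonneg _)) (fun x => sq_nonneg _)
    (norm_sq_conjSynthesis_le u₀) hε (fun n x => ?_) i
  rw [← RCLike.norm_ofReal (K := 𝕜), RCLike.ofReal_sub, RCLike.ofReal_mul, norm_sq_conjSynthesis,
    norm_sq_conjSynthesis]
  convert! norm_sum_sum_mul_le
    (fun j k => (t n : 𝕜) * ⟪u n j, u n k⟫_𝕜 - ⟪u₀ j, u₀ k⟫_𝕜) x using 2
  simp only [Finset.mul_sum, ← Finset.sum_sub_distrib, mul_sub, mul_left_comm (t n : 𝕜)]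

variable {κ : Type*} [Fintype κ] [DecidableEq κ]

theorem norm_adjoint_toEuclideanLin (A : Matrix ι κ 𝕜) (x : EuclideanSpace 𝕜 ι) :
    ‖LinearMap.adjoint (Matrix.toEuclideanLin A) x‖
      = ‖conjSynthesis (fun k => WithLp.toLp 2 (A k)) x‖ := by
  classical
  rw [← Matrix.toEuclideanLin_conjTranspose_eq_adjoint, conjSynthesis_apply,
    EuclideanSpace.norm_eq, EuclideanSpace.norm_eq]
  congr 1
  refine Finset.sum_congr rfl fun j _ => ?_
  rw [← RCLike.norm_conj]
  simp [Matrix.toLpLin_apply, Matrix.mulVec, dotProduct, mul_comm]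

theorem sq_singularValues_toEuclideanLin (A : Matrix ι κ 𝕜) (i : ℕ) :
    (Matrix.toEuclideanLin A).singularValues i ^ 2 = maxMin 𝕜
      (fun x : EuclideanSpace 𝕜 ι => ‖conjSynthesis (fun k => WithLp.toLp 2 (A k)) x‖ ^ 2) i := by
  simp only [sq_singularValues_eq_maxMin, ← maxMin_norm_sq_adjoint (Matrix.toEuclideanLin A),
    norm_adjoint_toEuclideanLin]

end GramLimit

theorem tendsto_inv_mul_succ {𝕜 : Type*} [RCLike 𝕜] {u : ℕ → 𝕜} {c : 𝕜}
    (h : Tendsto (fun n : ℕ => (n : 𝕜)⁻¹ * u n) atTop (𝓝 c)) :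
    Tendsto (fun n : ℕ => (n : 𝕜)⁻¹ * u (n + 1)) atTop (𝓝 c) := by
  have hone : Tendsto (fun n : ℕ => 1 + 1 / (n : 𝕜)) atTop (𝓝 1) := by
    simpa only [add_zero] using tendsto_one_div_atTop_nhds_zero_nat.const_add (1 : 𝕜)
  refine (one_mul c ▸ hone.mul (h.comp (tendsto_add_atTop_nat 1))).congr' ?_
  filter_upwards [eventually_ne_atTop 0] with n hn
  have hn₀ : (n : 𝕜) ≠ 0 := Nat.cast_ne_zero.2 hn
  have hn₁ : (n : 𝕜) + 1 ≠ 0 := Nat.cast_add_one_ne_zero n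
  simp only [Function.comp_apply, Nat.cast_add, Nat.cast_one]
  field_simp

namespace TimeSeries

theorem tendsto_average_trajectory {f : ℕ → ℂ} (hf : AutocovExists f) (k l : ℕ) :
    Tendsto (fun M : ℕ => (M : ℂ)⁻¹ * ∑ j ∈ Finset.range (M + 1), conj (f (j + k)) * f (j + l))
      atTop (𝓝 (meanInner (fun j => f (j + k)) fun j => f (j + l))) := by
  have hmean := tendsto_meanInner hf (Submodule.subset_span ⟨k, rfl⟩)
    (Submodule.subset_span ⟨l, rfl⟩)
  exact tendsto_inv_mul_succ (u := fun n => ∑ j ∈ Finset.range n, conj (f (j + k)) * f (j + l))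
    (hmean.congr fun n => by rw [timeAvg, one_div])

variable (f : ℕ → ℂ) (hf : AutocovExists f)

theorem koopman_coe (h : PreHilbert f hf) :
    koopman f hf (h : HilbertSpace f hf) = (preKoopman f hf h : HilbertSpace f hf) :=
  ContinuousLinearMap.completion_apply_coe _ h

/-- The time-shift operator on the Hilbert space of `f`, as a linear isometry. -/
noncomputable def koopmanIsometry : HilbertSpace f hf →ₗᵢ[ℂ] HilbertSpace f hf where
  toLinearMap := (koopman f hf).toLinearMap
  norm_map' x := by
    induction x using UniformSpace.Completion.induction_on with
    | hp => exact isClosed_eq (koopman f hf).continuous.norm continuous_norm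
    | ih h =>
      rw [ContinuousLinearMap.coe_coe, koopman_coe, UniformSpace.Completion.norm_coe,
        UniformSpace.Completion.norm_coe, (preKoopman f hf).norm_map]

theorem isEigenExpansion_iff {a ξ : ℕ → ℂ} {v : ℕ → HilbertSpace f hf} {r : HilbertSpace f hf} :
    IsEigenExpansion f hf a ξ v r ↔
      IsEigenvectorExpansion (koopmanIsometry f hf) (observable f hf) a ξ v r :=
  ⟨fun h => ⟨h.1, h.2, h.3, h.4, h.5, h.6⟩, fun h => ⟨h.1, h.2, h.3, h.4, h.5, h.6⟩⟩

/-- The shifted series `F_l = (f(l), f(l+1), …)` as an element of the pre-Hilbert space. -/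
def shifted (l : ℕ) : PreHilbert f hf := ⟨fun k => f (k + l), Submodule.subset_span ⟨l, rfl⟩⟩

theorem preKoopman_shifted (l : ℕ) : preKoopman f hf (shifted f hf l) = shifted f hf (l + 1) :=
  Subtype.ext <| funext fun k => congrArg f (Nat.succ_add_eq_add_succ k l)

theorem iterate_koopmanIsometry_observable (l : ℕ) :
    (koopmanIsometry f hf)^[l] (observable f hf) = (shifted f hf l : HilbertSpace f hf) := by
  induction l with
  | zero => rfl
  | succ l ih =>
    rw [Function.iterate_succ_apply', ih, ← preKoopman_shifted]
    exact koopman_coe f hf _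

theorem inner_iterate_koopmanIsometry_observable (k l : ℕ) :
    ⟪(koopmanIsometry f hf)^[k] (observable f hf), (koopmanIsometry f hf)^[l] (observable f hf)⟫_ℂ
      = meanInner (fun j => f (j + k)) fun j => f (j + l) := by
  rw [iterate_koopmanIsometry_observable, iterate_koopmanIsometry_observable,
    UniformSpace.Completion.inner_coe]
  rfl

theorem tendsto_sq_trajectorySingularValue (N i : ℕ) :
    Tendsto (fun M : ℕ => (M : ℝ)⁻¹ * trajectorySingularValue f N M i ^ 2) atTop
      (𝓝 (maxMin ℂ (fun x : EuclideanSpace ℂ (Fin (N + 1)) => ‖conjSynthesis (𝕜 := ℂ)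
        (fun k : Fin (N + 1) => (koopmanIsometry f hf)^[k] (observable f hf)) x‖ ^ 2) i)) := by
  refine (tendsto_maxMin_of_tendsto_inner (𝕜 := ℂ) (t := fun M : ℕ => (M : ℝ)⁻¹)
    (u := fun M k => WithLp.toLp 2 (trajectoryMatrix f N M k))
    (fun M => by positivity) (fun k l => ?_) i).congr' ?_
  · rw [inner_iterate_koopmanIsometry_observable]
    refine (tendsto_average_trajectory hf k l).congr fun M => ?_
    simp [trajectoryMatrix, PiLp.inner_apply, Finset.sum_range, mul_comm, add_comm]
  · filter_upwards [eventually_gt_atTop 0] with M hM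
    rw [trajectorySingularValue, sq_singularValues_toEuclideanLin,
      maxMin_const_mul (norm_sq_conjSynthesis_le _) (fun _ => sq_nonneg _) (by positivity) i]

end TimeSeries

theorem mainTheorem3 (f : ℕ → ℂ) (hf : TimeSeries.AutocovExists f) :
    (∃ (a ξ : ℕ → ℂ) (v : ℕ → TimeSeries.HilbertSpace f hf) (r : TimeSeries.HilbertSpace f hf),
      TimeSeries.IsEigenExpansion f hf a ξ v r) ∧
    ∀ (a ξ : ℕ → ℂ) (v : ℕ → TimeSeries.HilbertSpace f hf) (r : TimeSeries.HilbertSpace f hf),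
      TimeSeries.IsEigenExpansion f hf a ξ v r →
      ∀ i : ℕ, ∃ L : ℕ → ℝ,
        (∀ N : ℕ, Filter.Tendsto
          (fun M : ℕ => TimeSeries.trajectorySingularValue f N M i ^ 2 / ((N : ℝ) * (M : ℝ)))
          Filter.atTop (nhds (L N))) ∧
        Filter.Tendsto L Filter.atTop (nhds (‖a i‖ ^ 2)) := by
  refine ⟨?_, fun a ξ v r h i => ?_⟩
  · simp only [TimeSeries.isEigenExpansion_iff]
    exact exists_isEigenvectorExpansion (TimeSeries.koopmanIsometry f hf)
      (TimeSeries.observable f hf)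
  · refine ⟨fun N => (N : ℝ)⁻¹ * maxMin ℂ (fun x : EuclideanSpace ℂ (Fin (N + 1)) =>
      ‖conjSynthesis (𝕜 := ℂ) (fun k : Fin (N + 1) =>
        (TimeSeries.koopmanIsometry f hf)^[k] (TimeSeries.observable f hf)) x‖ ^ 2) i,
      fun N => ?_, ?_⟩
    · refine ((TimeSeries.tendsto_sq_trajectorySingularValue f hf N i).const_mul
        (N : ℝ)⁻¹).congr fun M => ?_
      rw [div_eq_inv_mul, mul_inv, mul_assoc]
    · exact tendsto_inv_mul_succ
        (((TimeSeries.isEigenExpansion_iff f hf).1 h).tendsto_maxMin_orbit i)
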